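/- A finite digraph is a pair $G=(V,E)$ with $V$ a nonempty finite set and $E\subseteq V^2$ (loops are allowed). Let $\mathcal{D}$ be the set of isomorphism types of finite digraphs. For $G,G'\in\mathcal{D}$ write $G\le G'$ if there is an injective map $\varphi:V(G)\to V(G')$ such that $(u,v)\in E(G)$ implies $(\varphi(u),\varphi(v))\in E(G')$ (embeddability), and write $G\sqsubseteq G'$ if $G$ is isomorphic to the digraph induced by $G'$ on some subset of $V(G')$ (substructure). For a binary relation $\rho$ on $\mathcal{D}$ and $C\subseteq\mathcal{D}$, an $n$-ary relation $R\subseteq\mathcal{D}^n$ is definable in $(\mathcal{D};\rho,C)$ if there is a first-order formula $\Psi(x_1,\dots,x_n)$, in the language with equality, one binary relation symbol interpreted as $\rho$, and a constant symbol for each element of $C$, such that for all $a_1,\dots,a_n\in\mathcal{D}$, $\Psi(a_1,\dots,a_n)$ holds if and only if $(a_1,\dots,a_n)\in R$. **Theorem.** There is a finite set $\{C_1,\dots,C_k\}$ of finite digraphs such that the binary relation $\{(G,G')\in\mathcal{D}^2 : G\le G'\}$ is definable in $(\mathcal{D};\sqsubseteq,C_1,\dots,C_k)$; in fact the (finite)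 set of all isomorphism types of digraphs with at most $4$ vertices has this property. Consequently, for this same set and every $n$, every $n$-ary relation on $\mathcal{D}$ that is definable in $(\mathcal{D};\le)$ (without constants) is definable in $(\mathcal{D};\sqsubseteq,C_1,\dots,C_k)$. -/

import Mathlib

open FirstOrder

/-- A finite digraph: a nonempty finite vertex set with an arbitrary binary edge relation
(loops and pairs of opposite edges are allowed). -/
structure FinDigraph where
  V : Type
  [finite : Finite V]
  [nonempty : Nonempty V]
  graph : Digraph V

namespace FinDigraph

/-- Isomorphism of digraphs. -/
def Iso (G H : FinDigraph) : Prop :=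
  Nonempty (G.graph.Adj ≃r H.graph.Adj)

/-- `G` is embeddable into `H`: there is an injective homomorphism from `G` to `H`. -/
def Embeds (G H : FinDigraph) : Prop :=
  ∃ f : G.V → H.V, Function.Injective f ∧ ∀ v w, G.graph.Adj v w → H.graph.Adj (f v) (f w)

/-- `G` is a substructure of `H`: it is isomorphic to the digraph that `H` induces on some
set of vertices. -/
def IsSub (G H : FinDigraph) : Prop :=
  ∃ S : Set H.V, Nonempty (G.graph.Adj ≃r fun v w : S => H.graph.Adj v w)

theorem isSub_iff (G H : FinDigraph) :
    G.IsSub H ↔ Nonempty (G.graph.Adj ↪r H.graph.Adj) := by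
  constructor
  · rintro ⟨S, ⟨e⟩⟩
    exact ⟨⟨⟨fun v => (e v : H.V), fun a b h => e.injective (Subtype.ext h)⟩,
      fun {a b} => e.map_rel_iff⟩⟩
  · rintro ⟨f⟩
    exact ⟨Set.range f, ⟨⟨Equiv.ofInjective f f.injective, fun {a b} => f.map_rel_iff⟩⟩⟩

instance setoid : Setoid FinDigraph where
  r := Iso
  iseqv :=
    { refl := fun _ => ⟨RelIso.refl _⟩
      symm := fun ⟨e⟩ => ⟨e.symm⟩
      trans := fun ⟨e⟩ ⟨f⟩ => ⟨e.trans f⟩ }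

theorem Embeds.congr {G G' H H' : FinDigraph} (hG : G.Iso G') (hH : H.Iso H')
    (h : G.Embeds H) : G'.Embeds H' := by
  obtain ⟨e⟩ := hG
  obtain ⟨e'⟩ := hH
  obtain ⟨f, hf, hadj⟩ := h
  exact ⟨fun v => e' (f (e.symm v)), e'.injective.comp (hf.comp e.symm.injective),
    fun v w hvw => e'.map_rel_iff.2 (hadj _ _ (e.symm.map_rel_iff.2 hvw))⟩

theorem IsSub.congr {G G' H H' : FinDigraph} (hG : G.Iso G') (hH : H.Iso H')
    (h : G.IsSub H) : G'.IsSub H' := by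
  obtain ⟨e⟩ := hG
  obtain ⟨e'⟩ := hH
  rw [isSub_iff] at h ⊢
  obtain ⟨f⟩ := h
  exact ⟨(e.symm.toRelEmbedding.trans f).trans e'.toRelEmbedding⟩

end FinDigraph

/-- The set `𝒟` of isomorphism types of finite digraphs. -/
def DigraphType : Type 1 := Quotient FinDigraph.setoid

namespace DigraphType

/-- The number of vertices. -/
noncomputable def order : DigraphType → ℕ :=
  Quotient.lift (fun G => Nat.card G.V) fun _ _ ⟨e⟩ => Nat.card_congr e.toEquiv

/-- The embeddability order `≤` on `𝒟`. -/
def Embeds : DigraphType → DigraphType → Prop :=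
  Quotient.lift₂ FinDigraph.Embeds fun _ _ _ _ hG hH =>
    propext ⟨FinDigraph.Embeds.congr hG hH,
      FinDigraph.Embeds.congr (Setoid.symm hG) (Setoid.symm hH)⟩

/-- The substructure order `⊑` on `𝒟`. -/
def IsSub : DigraphType → DigraphType → Prop :=
  Quotient.lift₂ FinDigraph.IsSub fun _ _ _ _ hG hH =>
    propext ⟨FinDigraph.IsSub.congr hG hH,
      FinDigraph.IsSub.congr (Setoid.symm hG) (Setoid.symm hH)⟩

/-- `𝒟` as a structure for the language with one binary relation symbol, interpreted by `r`. -/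
@[reducible]
def relStructure (r : DigraphType → DigraphType → Prop) :
    Language.order.Structure DigraphType where
  RelMap | .le => fun x => r (x 0) (x 1)

/-- The relation `R` is first-order definable in `(𝒟; r, C)`, where each element of `C` is named
by a constant symbol. -/
def DefinableIn (r : DigraphType → DigraphType → Prop) (C : Set DigraphType) {n : ℕ}
    (R : Set (Fin n → DigraphType)) : Prop :=
  letI := relStructure r
  C.Definable Language.order R

/-- The isomorphism types of digraphs with at most four vertices. -/
def small : Set DigraphType := {G | G.order ≤ 4}

end DigraphType

/-!
To compare `G` and `H` for embeddability by means of `⊑`, number their vertices. Put `G` into a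
frame: a larger digraph that contains `G`, a full digraph `K` and an edgeless digraph. Each vertex
of `K` is joined to each vertex of the edgeless digraph by exactly one edge, no edge goes from `K`
to `G`, and every vertex of `G` sends edges to all of the edgeless digraph. There is only one copy
of `K` in a frame, so that one can speak of the digraphs spanned by `K` and one or two further
vertices: they are the digraphs above `K` by one or two steps of the covering relation, and what
they look like is expressed by the digraphs with at most four vertices below them. The edgeless
part is handled by duality (reversed non-edges), which is an automorphism of `(𝒟; ⊑)`, and `G` is
the greatest lower bound of the frame without the full digraph and the frame without the edgeless
one.

The number of a vertex of `G` is the number of its out-neighbours in `K`. Two vertices, possibly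
of different frames, have the same number iff the same full digraphs are spanned by
out-neighbours of them. If the out-neighbourhoods form a chain, then two distinct vertices have
different numbers, and the direction of an edge between them can be expressed by saying whether it
goes to the vertex with the larger number. So it is definable that sending each vertex of `G` to the
vertex of `H` with the same number is a homomorphism, which is then injective. Conversely, an
embedding of `G` into `H` becomes such a map once `H` is numbered and `G` gets the numbers of the
images.
-/

/-! ### First-order definability -/

section FirstOrderDefinability

open FirstOrder.Language

variable {L L' : Language} {M : Type*} [L.Structure M] {A : Set M} {α : Type*}

theorem definable_setOf_comp_mem_of_equiv {s : Set (α → M)} (hs : A.Definable L s) (σ : M ≃[L] M)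
    (hσ : ∀ a ∈ A, σ.symm a ∈ A) : A.Definable L {v | σ ∘ v ∈ s} := by
  obtain ⟨φ, rfl⟩ := Set.definable_iff_exists_formula_sum.1 hs
  refine Set.definable_iff_exists_formula_sum.2
    ⟨φ.relabel (Sum.map (fun a : A => ⟨σ.symm a, hσ a a.2⟩) id), Set.ext fun v => ?_⟩
  have hv : (Sum.elim (↑) v ∘ Sum.map (fun a : A => (⟨σ.symm a, hσ a a.2⟩ : A)) id : A ⊕ α → M) =
      σ.symm ∘ Sum.elim (↑) (σ ∘ v) := by
    ext (a | i)
    · rfl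
    · exact (σ.symm_apply_apply (v i)).symm
  rw [Set.mem_ofPred_eq, Set.mem_ofPred_eq, Set.mem_ofPred_eq, Formula.realize_relabel, hv,
    StrongHomClass.realize_formula]

variable [L'.Structure M] [L'.IsRelational]

theorem exists_forall_realize_eq_apply (t : L'.Term α) : ∃ i, ∀ v : α → M, t.realize v = v i := by
  cases t with
  | var i => exact ⟨i, fun _ => rfl⟩
  | func f _ => exact isEmptyElim f

theorem definable_setOf_forall_of_snoc {n : ℕ} {S : (α → M) → (Fin (n + 1) → M) → Prop}
    (hS : A.Definable L {v : α ⊕ Fin (n + 1) → M | S (v ∘ Sum.inl) (v ∘ Sum.inr)}) :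
    A.Definable L {v : α ⊕ Fin n → M |
      ∀ x, S (v ∘ Sum.inl) (Fin.snoc (v ∘ Sum.inr) x)} := by
  let g : α ⊕ Fin (n + 1) → (α ⊕ Fin n) ⊕ Unit :=
    Sum.elim (fun a => .inl (.inl a)) (Fin.lastCases (.inr ()) fun j => .inl (.inr j))
  have snoc_eq (v : α ⊕ Fin n → M) (u : Unit → M) :
      (Sum.elim v u ∘ g) ∘ Sum.inr = Fin.snoc (α := fun _ => M) (v ∘ Sum.inr) (u ()) := by
    funext j
    refine Fin.lastCases ?_ (fun j => ?_) j <;> simp [g]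
  convert! (hS.preimage_comp g).forall_of_finite using 1
  ext v
  simp only [Set.mem_preimage, Set.mem_ofPred_eq, snoc_eq]
  exact ⟨fun h u => h _, fun h x => h fun _ => x⟩

theorem definable_setOf_realize
    (h : ∀ (n : ℕ) (R : L'.Relations n), A.Definable L {x : Fin n → M | Structure.RelMap R x})
    {n : ℕ} (φ : L'.BoundedFormula α n) :
    A.Definable L {v : α ⊕ Fin n → M | φ.Realize (v ∘ Sum.inl) (v ∘ Sum.inr)} := by
  induction φ with
  | falsum => exact Set.definable_empty
  | equal t₁ t₂ =>
    obtain ⟨i, hi⟩ := exists_forall_realize_eq_apply (M := M) t₁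
    obtain ⟨j, hj⟩ := exists_forall_realize_eq_apply (M := M) t₂
    simp only [BoundedFormula.Realize, Sum.elim_comp_inl_inr, hi, hj]
    exact (Set.Definable.diagonal L A).preimage_comp ![i, j]
  | rel R ts =>
    choose i hi using fun k => exists_forall_realize_eq_apply (M := M) (ts k)
    simp only [BoundedFormula.Realize, Sum.elim_comp_inl_inr, hi]
    exact (h _ R).preimage_comp i
  | imp f g hf hg => exact hf.himp hg
  | all f hf => exact definable_setOf_forall_of_snoc hf

theorem definable_of_definable_empty
    (h : ∀ (n : ℕ) (R : L'.Relations n), A.Definable L {x : Fin n → M | Structure.RelMap R x})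
    {s : Set (α → M)} (hs : (∅ : Set M).Definable L' s) : A.Definable L s := by
  obtain ⟨φ, rfl⟩ := Set.empty_definable_iff.1 hs
  convert! (definable_setOf_realize h φ).preimage_comp (Sum.elim id Fin.elim0) using 1
  ext v
  exact iff_of_eq (congrArg (BoundedFormula.Realize φ v) (Subsingleton.elim default _))

end FirstOrderDefinability

/-! ### Digraphs under the substructure order -/

namespace FinDigraph

attribute [instance] FinDigraph.finite FinDigraph.nonempty

variable {G H K W Z : FinDigraph}

/-- The edge relation of a digraph. -/
abbrev Adj (G : FinDigraph) : G.V → G.V → Prop := G.graph.Adj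

/-- The isomorphisms of `G` onto an induced subdigraph of `H`. -/
abbrev Emb (G H : FinDigraph) : Type := G.Adj ↪r H.Adj

/-- Digraphs are preordered by the substructure relation `⊑`, so that the order notions of the
library apply to it; the embeddability order of the paper is `Embeds`. -/
instance : Preorder FinDigraph where
  le := IsSub
  le_refl G := (isSub_iff G G).2 ⟨RelEmbedding.refl _⟩
  le_trans G H K hGH hHK := by
    obtain ⟨f⟩ := (isSub_iff G H).1 hGH
    obtain ⟨g⟩ := (isSub_iff H K).1 hHK
    exact (isSub_iff G K).2 ⟨f.trans g⟩

theorem le_iff_nonempty_emb : G ≤ H ↔ Nonempty (Emb G H) :=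
  isSub_iff G H

theorem Emb.le (f : Emb G H) : G ≤ H :=
  le_iff_nonempty_emb.2 ⟨f⟩

theorem card_le_of_le (h : G ≤ H) : Nat.card G.V ≤ Nat.card H.V :=
  let ⟨f⟩ := le_iff_nonempty_emb.1 h
  Nat.card_le_card_of_injective f f.injective

theorem equiv_of_le_of_card_le (h : G ≤ H) (hcard : Nat.card H.V ≤ Nat.card G.V) : G ≈ H := by
  obtain ⟨f⟩ := le_iff_nonempty_emb.1 h
  exact ⟨RelIso.ofSurjective f <|
    (f.injective.bijective_of_nat_card_le hcard).surjective⟩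

theorem le_of_equiv (h : G ≈ H) : G ≤ H :=
  let ⟨e⟩ := h
  Emb.le e.toRelEmbedding

theorem equiv_of_le_of_ge (h : G ≤ H) (h' : H ≤ G) : G ≈ H :=
  equiv_of_le_of_card_le h (card_le_of_le h')

theorem lt_iff_le_and_card_lt : G < H ↔ G ≤ H ∧ Nat.card G.V < Nat.card H.V := by
  refine ⟨fun h => ⟨h.le, ?_⟩, fun ⟨h, hcard⟩ => lt_of_le_not_ge h fun h' => ?_⟩
  · by_contra! hcard
    exact h.not_ge (le_of_equiv (Setoid.symm (equiv_of_le_of_card_le h.le hcard)))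
  · exact hcard.not_ge (card_le_of_le h')

/-- The subdigraph induced on a nonempty set of vertices. -/
def induce (G : FinDigraph) (S : Set G.V) (hS : S.Nonempty) : FinDigraph :=
  haveI := hS.to_subtype
  ⟨S, ⟨fun v w => G.Adj v w⟩⟩

theorem card_induce (S : Set G.V) (hS : S.Nonempty) : Nat.card (G.induce S hS).V = S.ncard :=
  Nat.card_coe_set_eq S

theorem le_induce_iff {S : Set G.V} {hS : S.Nonempty} :
    H ≤ G.induce S hS ↔ ∃ f : Emb H G, Set.range f ⊆ S := by
  rw [le_iff_nonempty_emb]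
  constructor
  · rintro ⟨f⟩
    exact ⟨⟨⟨fun v => (f v).1, fun v w h => f.injective (Subtype.ext h)⟩, f.map_rel_iff⟩,
      Set.range_subset_iff.2 fun v => (f v).2⟩
  · rintro ⟨f, hf⟩
    exact ⟨⟨⟨fun v => ⟨f v, hf ⟨v, rfl⟩⟩, fun v w h => f.injective (congrArg Subtype.val h)⟩,
      f.map_rel_iff⟩⟩

theorem le_induce_univ_iff : H ≤ G.induce Set.univ Set.univ_nonempty ↔ H ≤ G := by
  rw [le_induce_iff, le_iff_nonempty_emb]
  exact ⟨fun ⟨f, _⟩ => ⟨f⟩, fun ⟨f⟩ => ⟨f, Set.subset_univ _⟩⟩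

theorem induce_le (S : Set G.V) (hS : S.Nonempty) : G.induce S hS ≤ G :=
  let ⟨f, _⟩ := le_induce_iff.1 le_rfl
  Emb.le (H := G) f

theorem induce_mono {S T : Set G.V} {hS : S.Nonempty} {hT : T.Nonempty} (h : S ⊆ T) :
    G.induce S hS ≤ G.induce T hT :=
  let ⟨f, hf⟩ := le_induce_iff.1 le_rfl
  le_induce_iff.2 ⟨f, hf.trans h⟩

theorem ncard_range (f : Emb G H) : (Set.range f).ncard = Nat.card G.V := by
  rw [← Nat.card_coe_set_eq, Nat.card_range_of_injective f.injective]

theorem equiv_induce_range (f : Emb G H) : G ≈ H.induce (Set.range f) (Set.range_nonempty f) :=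
  equiv_of_le_of_card_le (le_induce_iff.2 ⟨f, subset_rfl⟩) (by rw [card_induce, ncard_range])

theorem covBy_iff_card : K ⋖ W ↔ K ≤ W ∧ Nat.card W.V = Nat.card K.V + 1 := by
  constructor
  · intro h
    obtain ⟨hle, hcard⟩ := lt_iff_le_and_card_lt.1 h.lt
    obtain ⟨f⟩ := le_iff_nonempty_emb.1 hle
    refine ⟨hle, by_contra fun hne => ?_⟩
    obtain ⟨v, hv⟩ : ∃ v, v ∉ Set.range f := by
      by_contra! hf
      rw [← ncard_range f, Set.eq_univ_of_forall hf, Set.ncard_univ] at hcard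
      exact hcard.false
    have hS := Set.ncard_insert_of_notMem hv
    rw [ncard_range] at hS
    refine h.2 (c := W.induce (insert v (Set.range f)) (Set.insert_nonempty _ _)) ?_ ?_
    · exact lt_iff_le_and_card_lt.2
        ⟨le_induce_iff.2 ⟨f, Set.subset_insert _ _⟩, by rw [card_induce]; omega⟩
    · exact lt_iff_le_and_card_lt.2 ⟨induce_le _ _, by rw [card_induce]; omega⟩
  · rintro ⟨hle, hcard⟩
    refine ⟨lt_iff_le_and_card_lt.2 ⟨hle, by omega⟩, fun X hKX hXW => ?_⟩
    have := (lt_iff_le_and_card_lt.1 hKX).2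
    have := (lt_iff_le_and_card_lt.1 hXW).2
    omega

theorem covBy_congr {K' W' : FinDigraph} (hK : K ≈ K') (hW : W ≈ W') : K ⋖ W ↔ K' ⋖ W' :=
  (covBy_congr_left ⟨le_of_equiv hK, le_of_equiv (Setoid.symm hK)⟩).trans
    (covBy_congr_right ⟨le_of_equiv hW, le_of_equiv (Setoid.symm hW)⟩)

theorem induce_covBy_induce_insert {S : Set G.V} {hS : S.Nonempty} {v : G.V} (hv : v ∉ S) :
    G.induce S hS ⋖ G.induce (insert v S) (Set.insert_nonempty _ _) := by
  refine covBy_iff_card.2 ⟨induce_mono (Set.subset_insert _ _), ?_⟩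
  rw [card_induce, card_induce, Set.ncard_insert_of_notMem hv]

theorem covBy_induce_insert (f : Emb K Z) {v : Z.V} (hv : v ∉ Set.range f) :
    K ⋖ Z.induce (insert v (Set.range f)) (Set.insert_nonempty _ _) :=
  (covBy_congr (equiv_induce_range f) (Setoid.refl _)).2 (induce_covBy_induce_insert hv)

theorem exists_range_eq_insert_of_covBy (h : K ⋖ W) (g : Emb W Z) :
    ∃ f : Emb K Z, ∃ v ∉ Set.range f, Set.range g = insert v (Set.range f) := by
  obtain ⟨hle, hcard⟩ := covBy_iff_card.1 h
  obtain ⟨k⟩ := le_iff_nonempty_emb.1 hle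
  have hsub : Set.range (k.trans g) ⊆ Set.range g := by
    rintro _ ⟨x, rfl⟩
    exact ⟨k x, rfl⟩
  obtain ⟨v, hv, hins⟩ := (Set.exists_eq_insert_iff_ncard (Set.toFinite _)).2
    ⟨hsub, by rw [ncard_range, ncard_range, hcard]⟩
  exact ⟨k.trans g, v, hv, hins.symm⟩

/-- The digraph whose edges are the reversed non-edges of `G`. -/
abbrev dual (G : FinDigraph) : FinDigraph := ⟨G.V, ⟨fun v w => ¬G.Adj w v⟩⟩

theorem dual_dual (G : FinDigraph) : G.dual.dual = G := by
  cases G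
  simp only [dual, Adj, not_not]

/-- An embedding of `G` into `H`, as an embedding of the duals. -/
abbrev Emb.dual (f : Emb G H) : Emb G.dual H.dual := ⟨f.toEmbedding, not_congr f.map_rel_iff⟩

theorem dual_le_dual_iff : G.dual ≤ H.dual ↔ G ≤ H := by
  have dual_mono {G H : FinDigraph} (h : G ≤ H) : G.dual ≤ H.dual :=
    let ⟨f⟩ := le_iff_nonempty_emb.1 h
    Emb.le f.dual
  exact ⟨fun h => by simpa only [dual_dual] using dual_mono h, dual_mono⟩

end FinDigraph

namespace DigraphType

open FirstOrder.Language

theorem finite_setOf_order_le (n : ℕ) : {G : DigraphType | G.order ≤ n}.Finite := by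
  classical
  let mk : (Σ k : Fin n, Digraph (Fin (k + 1))) → DigraphType :=
    fun p => Quotient.mk _ ⟨Fin (p.1 + 1), p.2⟩
  refine (Set.finite_range mk).subset fun x hx => ?_
  induction x using Quotient.inductionOn with
  | h G =>
    have hpos : 0 < Nat.card G.V := Nat.card_pos
    have hk : Nat.card G.V - 1 + 1 = Nat.card G.V := Nat.sub_add_cancel hpos
    have hcard : Nat.card G.V ≤ n := hx
    let e : Fin (Nat.card G.V - 1 + 1) ≃ G.V := (finCongr hk).trans (Finite.equivFin G.V).symm
    exact ⟨⟨⟨Nat.card G.V - 1, by omega⟩, ⟨fun a b => G.Adj (e a) (e b)⟩⟩,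
      Quotient.sound ⟨⟨e, Iff.rfl⟩⟩⟩

/-- `𝒟` with the substructure order, as a first-order structure. -/
@[reducible]
def subStructure : Language.order.Structure DigraphType := relStructure IsSub

end DigraphType

attribute [local instance] DigraphType.subStructure

namespace DigraphType

open FirstOrder.Language

/-- Duality as a map of isomorphism types. -/
def dual : DigraphType → DigraphType :=
  Quotient.map FinDigraph.dual fun _ _ ⟨e⟩ => ⟨⟨e.toEquiv, not_congr e.map_rel_iff⟩⟩

theorem dual_dual (G : DigraphType) : G.dual.dual = G := by
  induction G using Quotient.inductionOn with
  | h G => exact congrArg (Quotient.mk _) G.dual_dual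

theorem order_dual (G : DigraphType) : G.dual.order = G.order := by
  induction G using Quotient.inductionOn with
  | h G => rfl

/-- Duality as an automorphism of `(𝒟; ⊑)`. -/
def dualEquiv : DigraphType ≃[Language.order] DigraphType where
  toFun := dual
  invFun := dual
  left_inv := dual_dual
  right_inv := dual_dual
  map_fun' f := isEmptyElim f
  map_rel' R x := by
    cases R with
    | le =>
      change IsSub (x 0).dual (x 1).dual ↔ IsSub (x 0) (x 1)
      induction x 0, x 1 using Quotient.inductionOn₂ with
      | h G H => exact FinDigraph.dual_le_dual_iff

theorem definable_setOf_isSub {α : Type} (t u : small ⊕ α) :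
    small.Definable Language.order
      {v : α → DigraphType | IsSub (Sum.elim (↑) v t) (Sum.elim (↑) v u)} :=
  Set.definable_iff_exists_formula_sum.2
    ⟨Relations.formula₂ (L := Language.order) orderRel.le (.var t) (.var u), Set.ext fun v =>
      (Formula.realize_rel₂ (L := Language.order) (R := orderRel.le) (t₁ := .var t)
        (t₂ := .var u) (v := Sum.elim (fun F : small => (F : DigraphType)) v)).symm⟩

end DigraphType

/-! ### Definable properties of digraphs -/

/-- A property of families of digraphs is definable if it is invariant under isomorphism and
given by a first-order formula over `(𝒟; ⊑)` with constants for the small digraphs. -/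
def DefinableProp {α : Type} (P : (α → FinDigraph) → Prop) : Prop :=
  ∃ s : Set (α → DigraphType), DigraphType.small.Definable Language.order s ∧
    ∀ v, P v ↔ (fun a => (Quotient.mk _ (v a) : DigraphType)) ∈ s

namespace DefinableProp

open DigraphType FirstOrder.Language Sum

variable {α β : Type} {P Q : (α → FinDigraph) → Prop}

theorem equiv_iff (h : DefinableProp P) {v w : α → FinDigraph} (hvw : ∀ a, v a ≈ w a) :
    P v ↔ P w := by
  obtain ⟨s, -, hP⟩ := h
  rw [hP v, hP w, funext fun a => Quotient.sound (hvw a)]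

theorem congr (h : DefinableProp P) (hPQ : ∀ v, Q v ↔ P v) : DefinableProp Q :=
  funext (fun v => propext (hPQ v)) ▸ h

theorem comp (h : DefinableProp P) (f : α → β) : DefinableProp fun v => P (v ∘ f) := by
  obtain ⟨s, hs, hP⟩ := h
  exact ⟨_, hs.preimage_comp f, fun v => hP (v ∘ f)⟩

theorem not (h : DefinableProp P) : DefinableProp fun v => ¬P v := by
  obtain ⟨s, hs, hP⟩ := h
  exact ⟨sᶜ, hs.compl, fun v => not_congr (hP v)⟩

theorem and (h : DefinableProp P) (h' : DefinableProp Q) : DefinableProp fun v => P v ∧ Q v := by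
  obtain ⟨s, hs, hP⟩ := h
  obtain ⟨t, ht, hQ⟩ := h'
  exact ⟨s ∩ t, hs.inter ht, fun v => and_congr (hP v) (hQ v)⟩

theorem or (h : DefinableProp P) (h' : DefinableProp Q) : DefinableProp fun v => P v ∨ Q v :=
  (h.not.and h'.not).not.congr fun _ => or_iff_not_and_not

theorem imp (h : DefinableProp P) (h' : DefinableProp Q) : DefinableProp fun v => P v → Q v :=
  (h.not.or h').congr fun _ => imp_iff_not_or

theorem iff (h : DefinableProp P) (h' : DefinableProp Q) : DefinableProp fun v => P v ↔ Q v :=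
  ((h.imp h').and (h'.imp h)).congr fun _ => iff_def

theorem ex {P : (α → FinDigraph) → FinDigraph → Prop}
    (h : DefinableProp fun v : α ⊕ Unit → FinDigraph => P (v ∘ .inl) (v (inr ()))) :
    DefinableProp fun v => ∃ X, P v X := by
  obtain ⟨s, hs, hP⟩ := h
  have mk_elim (v : α → FinDigraph) (X : FinDigraph) :
      (fun a => (Quotient.mk _ (Sum.elim v (fun _ => X) a) : DigraphType)) =
        Sum.elim (fun a => Quotient.mk _ (v a)) fun _ : Unit => Quotient.mk _ X :=
    funext (Sum.rec (fun _ => rfl) fun _ => rfl)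
  refine ⟨_, hs.exists_of_finite, fun v => ⟨fun ⟨X, hX⟩ => ⟨fun _ => Quotient.mk _ X, ?_⟩, ?_⟩⟩
  · exact mk_elim v X ▸ (hP (Sum.elim v fun _ => X)).1 hX
  · rintro ⟨u, hu⟩
    obtain ⟨X, hX⟩ := Quotient.exists_rep (u ())
    obtain rfl : (fun _ => Quotient.mk _ X) = u := funext fun _ => hX
    exact ⟨X, (hP (Sum.elim v fun _ => X)).2 ((mk_elim v X).symm ▸ hu)⟩

theorem all {P : (α → FinDigraph) → FinDigraph → Prop}
    (h : DefinableProp fun v : α ⊕ Unit → FinDigraph => P (v ∘ .inl) (v (inr ()))) :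
    DefinableProp fun v => ∀ X, P v X :=
  (ex (P := fun v X => ¬P v X) h.not).not.congr fun _ => not_exists_not.symm

theorem dual (h : DefinableProp P) : DefinableProp fun v => P fun a => (v a).dual := by
  obtain ⟨s, hs, hP⟩ := h
  refine ⟨_, definable_setOf_comp_mem_of_equiv hs dualEquiv fun G hG => ?_, fun v => hP _⟩
  exact (order_dual G).trans_le hG

theorem le (i j : α) : DefinableProp fun v => v i ≤ v j :=
  ⟨_, definable_setOf_isSub (.inr i) (.inr j), fun _ => Iff.rfl⟩

theorem exists_mem_le {S : Set DigraphType} (hS : S ⊆ small) (i : α) :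
    DefinableProp fun v => ∃ F : FinDigraph, (Quotient.mk _ F : DigraphType) ∈ S ∧ F ≤ v i := by
  have : Finite S := ((finite_setOf_order_le 4).subset hS).to_subtype
  refine ⟨⋃ F : S, {v | IsSub F (v i)}, Set.definable_iUnion_of_finite fun F =>
    definable_setOf_isSub (.inl ⟨F, hS F.2⟩) (.inr i), fun v => ⟨?_, ?_⟩⟩
  · rintro ⟨F, hF, h⟩
    exact Set.mem_iUnion.2 ⟨⟨_, hF⟩, h⟩
  · intro h
    obtain ⟨⟨x, hx⟩, h⟩ := Set.mem_iUnion.1 h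
    obtain ⟨F, rfl⟩ := Quotient.exists_rep x
    exact ⟨F, hx, h⟩

theorem exists_vertices (p : (Fin 4 → Fin 4 → Prop) → (Fin 4 → Fin 4 → Prop) → Prop) (i : α) :
    DefinableProp fun v => ∃ t : Fin 4 → (v i).V,
      p (fun a b => (v i).Adj (t a) (t b)) fun a b => t a = t b := by
  let T (G : FinDigraph) : Prop :=
    ∃ t : Fin 4 → G.V, p (fun a b => G.Adj (t a) (t b)) fun a b => t a = t b
  have T_mono {F G : FinDigraph} (hFG : F ≤ G) : T F → T G := by
    rintro ⟨t, ht⟩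
    obtain ⟨f⟩ := FinDigraph.le_iff_nonempty_emb.1 hFG
    refine ⟨f ∘ t, ?_⟩
    simpa only [Function.comp, f.map_rel_iff, f.injective.eq_iff] using ht
  let S : Set DigraphType := {x | x ∈ small ∧ ∃ F, Quotient.mk _ F = x ∧ T F}
  refine (exists_mem_le (S := S) (fun x hx => hx.1) i).congr fun v => ⟨?_, ?_⟩
  · rintro ⟨t, ht⟩
    refine ⟨(v i).induce (Set.range t) (Set.range_nonempty t), ⟨?_, _, rfl, ?_⟩,
      FinDigraph.induce_le _ _⟩
    · exact (Nat.card_le_card_of_surjective _ Set.rangeFactorization_surjective).trans_eq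
        (Nat.card_fin 4)
    · refine ⟨Set.rangeFactorization t, ?_⟩
      simpa only [FinDigraph.induce, Set.rangeFactorization, Subtype.mk.injEq] using ht
  · rintro ⟨F, ⟨-, F', hF', h⟩, hF⟩
    exact T_mono ((FinDigraph.le_of_equiv (Quotient.exact hF')).trans hF) h

theorem exists_four (p : (Fin 4 → Fin 4 → Prop) → (Fin 4 → Fin 4 → Prop) → Prop) (i : α) :
    DefinableProp fun v => ∃ x y z w : (v i).V,
      p (fun a b => (v i).Adj (![x, y, z, w] a) (![x, y, z, w] b))
        fun a b => ![x, y, z, w] a = ![x, y, z, w] b :=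
  (exists_vertices p i).congr fun v =>
    ⟨fun ⟨x, y, z, w, h⟩ => ⟨![x, y, z, w], h⟩, fun ⟨t, h⟩ => ⟨t 0, t 1, t 2, t 3, by
      rwa [show ![t 0, t 1, t 2, t 3] = t from funext fun a => by fin_cases a <;> rfl]⟩⟩

theorem lt (i j : α) : DefinableProp fun v => v i < v j :=
  ((le i j).and (le j i).not).congr fun _ => lt_iff_le_not_ge

theorem covBy (i j : α) : DefinableProp fun v => v i ⋖ v j :=
  (lt i j).and (all ((lt (inl i) (inr ())).imp (lt (inr ()) (inl j)).not))

theorem isGLB_pair (i j k : α) : DefinableProp fun v => IsGLB {v i, v j} (v k) :=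
  (((le k i).and (le k j)).and (all (P := fun v X => X ≤ v i ∧ X ≤ v j → X ≤ v k)
    (((le (inr ()) (inl i)).and (le (inr ()) (inl j))).imp (le (inr ()) (inl k))))).congr
      fun v => by simp only [IsGLB, IsGreatest, mem_upperBounds, lowerBounds_insert,
        lowerBounds_singleton, Set.mem_inter_iff, Set.mem_Iic]

end DefinableProp

/-! ### Extensions by free and by joined vertices -/

namespace FinDigraph

variable {K W X Z : FinDigraph} {Q : Set Z.V} {T : FinDigraph → Prop}

/-- Every digraph between `K` and `Z` with one vertex more than `K` has the property `T`. -/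
def AllCovers (T : FinDigraph → Prop) (K Z : FinDigraph) : Prop :=
  K ≤ Z ∧ ∀ W, K ⋖ W → W ≤ Z → T W

/-- Every digraph between `K` and `Z` with two vertices more than `K` has the property `T`. -/
def AllCovers₂ (T : FinDigraph → Prop) (K Z : FinDigraph) : Prop :=
  K ≤ Z ∧ ∀ W X, K ⋖ W → W ⋖ X → X ≤ Z → T X

/-- `Q` is the only set of vertices of `Z` that induces a digraph isomorphic to `K`. -/
def IsOnlyCopy (K : FinDigraph) (Q : Set Z.V) : Prop :=
  K ≤ Z ∧ ∀ f : Emb K Z, Set.range f = Q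

theorem AllCovers.induce (h : AllCovers T K Z) (f : Emb K Z) {v : Z.V} (hv : v ∉ Set.range f) :
    T (Z.induce (insert v (Set.range f)) (Set.insert_nonempty _ _)) :=
  h.2 _ (covBy_induce_insert f hv) (induce_le _ _)

theorem AllCovers₂.induce (h : AllCovers₂ T K Z) (f : Emb K Z) {v w : Z.V}
    (hv : v ∉ Set.range f) (hw : w ∉ insert v (Set.range f)) :
    T (Z.induce (insert w (insert v (Set.range f))) (Set.insert_nonempty _ _)) :=
  h.2 _ _ (covBy_induce_insert f hv) (induce_covBy_induce_insert hw) (induce_le _ _)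

theorem IsOnlyCopy.exists_emb (h : IsOnlyCopy K Q) : ∃ f : Emb K Z, Set.range f = Q :=
  let ⟨f⟩ := le_iff_nonempty_emb.1 h.1
  ⟨f, h.2 f⟩

theorem IsOnlyCopy.covBy_and_le_induce_iff (h : IsOnlyCopy K Q) {S : Set Z.V} {hS : S.Nonempty}
    (hQS : Q ⊆ S) : K ⋖ W ∧ W ≤ Z.induce S hS ↔
      ∃ v ∈ S, v ∉ Q ∧ W ≈ Z.induce (insert v Q) (Set.insert_nonempty _ _) := by
  constructor
  · rintro ⟨hKW, hWZ⟩
    obtain ⟨g, hgS⟩ := le_induce_iff.1 hWZ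
    obtain ⟨f, v, hv, hg⟩ := exists_range_eq_insert_of_covBy hKW g
    obtain rfl := h.2 f
    refine ⟨v, hgS (hg ▸ Set.mem_insert _ _), hv, ?_⟩
    simpa only [hg] using equiv_induce_range g
  · rintro ⟨v, hvS, hv, hW⟩
    obtain ⟨f, rfl⟩ := h.exists_emb
    exact ⟨(covBy_congr (Setoid.refl K) hW).2 (covBy_induce_insert f hv),
      (le_of_equiv hW).trans (induce_mono (Set.insert_subset hvS hQS))⟩

theorem IsOnlyCopy.covBy_and_le_iff (h : IsOnlyCopy K Q) :
    K ⋖ W ∧ W ≤ Z ↔ ∃ v ∉ Q, W ≈ Z.induce (insert v Q) (Set.insert_nonempty _ _) := by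
  simpa only [le_induce_univ_iff, Set.mem_univ, true_and] using
    h.covBy_and_le_induce_iff (W := W) (hS := Set.univ_nonempty) (Set.subset_univ Q)

theorem IsOnlyCopy.covBy_covBy_and_le_iff (h : IsOnlyCopy K Q) :
    (∃ W, K ⋖ W ∧ W ⋖ X ∧ X ≤ Z) ↔ ∃ v ∉ Q, ∃ w ∉ insert v Q,
      X ≈ Z.induce (insert w (insert v Q)) (Set.insert_nonempty _ _) := by
  constructor
  · rintro ⟨W, hKW, hWX, hXZ⟩
    obtain ⟨g⟩ := le_iff_nonempty_emb.1 hXZ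
    obtain ⟨k, w, hw, hg⟩ := exists_range_eq_insert_of_covBy hWX g
    obtain ⟨f, v, hv, hk⟩ := exists_range_eq_insert_of_covBy hKW k
    obtain rfl := h.2 f
    refine ⟨v, hv, w, hk ▸ hw, ?_⟩
    simpa only [hg, hk] using equiv_induce_range g
  · rintro ⟨v, hv, w, hw, hX⟩
    obtain ⟨f, rfl⟩ := h.exists_emb
    exact ⟨_, covBy_induce_insert f hv,
      (covBy_congr (Setoid.refl _) hX).2 (induce_covBy_induce_insert hw),
      (le_of_equiv hX).trans (induce_le _ _)⟩

theorem IsOnlyCopy.allCovers_induce_iff (h : IsOnlyCopy K Q) {S : Set Z.V} {hS : S.Nonempty}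
    (hQS : Q ⊆ S) (hT : DefinableProp fun v : Unit → FinDigraph => T (v ())) :
    AllCovers T K (Z.induce S hS) ↔
      ∀ v ∈ S, v ∉ Q → T (Z.induce (insert v Q) (Set.insert_nonempty _ _)) := by
  obtain ⟨f, hf⟩ := h.exists_emb
  refine ⟨fun hall v hvS hv => ?_, fun hall =>
    ⟨le_induce_iff.2 ⟨f, hf.trans_subset hQS⟩, fun W hKW hWZ => ?_⟩⟩
  · obtain ⟨hK, hZ⟩ := (h.covBy_and_le_induce_iff hQS).2 ⟨v, hvS, hv, Setoid.refl _⟩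
    exact hall.2 _ hK hZ
  · obtain ⟨v, hvS, hv, hW⟩ := (h.covBy_and_le_induce_iff hQS).1 ⟨hKW, hWZ⟩
    exact (hT.equiv_iff (v := fun _ => W) fun _ => hW).2 (hall v hvS hv)

theorem IsOnlyCopy.allCovers_iff (h : IsOnlyCopy K Q)
    (hT : DefinableProp fun v : Unit → FinDigraph => T (v ())) :
    AllCovers T K Z ↔ ∀ v ∉ Q, T (Z.induce (insert v Q) (Set.insert_nonempty _ _)) := by
  simpa only [AllCovers, le_induce_univ_iff, Set.mem_univ, true_imp_iff] using
    h.allCovers_induce_iff (hS := Set.univ_nonempty) (Set.subset_univ Q) hT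

theorem IsOnlyCopy.allCovers₂_iff (h : IsOnlyCopy K Q)
    (hT : DefinableProp fun v : Unit → FinDigraph => T (v ())) :
    AllCovers₂ T K Z ↔ ∀ v ∉ Q, ∀ w ∉ insert v Q,
      T (Z.induce (insert w (insert v Q)) (Set.insert_nonempty _ _)) := by
  refine ⟨fun hall v hv w hw => ?_, fun hall => ⟨h.1, fun W X hKW hWX hXZ => ?_⟩⟩
  · obtain ⟨W, hKW, hWX, hXZ⟩ := h.covBy_covBy_and_le_iff.2 ⟨v, hv, w, hw, Setoid.refl _⟩
    exact hall.2 W _ hKW hWX hXZ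
  · obtain ⟨v, hv, w, hw, hX⟩ := h.covBy_covBy_and_le_iff.1 ⟨W, hKW, hWX, hXZ⟩
    exact (hT.equiv_iff (v := fun _ => X) fun _ => hX).2 (hall v hv w hw)

/-- Every pair of vertices, equal or not, is joined by an edge. -/
def IsFull (G : FinDigraph) : Prop := ∀ v w, G.Adj v w

/-- The vertex `v` receives no edge from `Q` and does not send edges to all of `Q`. -/
def IsFreeAt (Q : Set Z.V) (v : Z.V) : Prop :=
  (∀ x ∈ Q, ¬Z.Adj x v) ∧ ∃ x ∈ Q, ¬Z.Adj v x

/-- The vertex `v` has no loop and is joined to each vertex of `Q` by exactly one edge. -/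
def IsJoinedAt (Q : Set Z.V) (v : Z.V) : Prop :=
  ¬Z.Adj v v ∧ ∀ x ∈ Q, (Z.Adj x v ↔ ¬Z.Adj v x)

/-- The extension of a full digraph `Q` by one vertex `v` satisfies this iff `IsFreeAt Q v`. -/
def IsFreeExt (W : FinDigraph) : Prop :=
  (∃ x q p, q ≠ p ∧ W.Adj q p ∧ W.Adj p q ∧ ¬W.Adj q x ∧ ¬W.Adj p x ∧ ¬W.Adj x p) ∧
    ¬∃ x q p, q ≠ p ∧ W.Adj q p ∧ W.Adj p q ∧ W.Adj q x ∧ ¬W.Adj p x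

/-- The extension of a full digraph `Q` by one vertex `v` satisfies this iff `IsJoinedAt Q v`. -/
def IsJoinedExt (W : FinDigraph) : Prop :=
  (∃ x, ¬W.Adj x x) ∧ ∀ x, ¬W.Adj x x → ∀ y, x ≠ y → (W.Adj y x ↔ ¬W.Adj x y)

/-- Two loopless vertices are adjacent, and all loopless vertices are joined to each looped vertex
by exactly one edge. -/
def HasAdjJoinedPair (X : FinDigraph) : Prop :=
  (∃ x y, ¬X.Adj x x ∧ ¬X.Adj y y ∧ X.Adj x y) ∧
    ∀ x, ¬X.Adj x x → ∀ y, X.Adj y y → (X.Adj y x ↔ ¬X.Adj x y)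

theorem exists_induce {S : Set Z.V} {hS : S.Nonempty} {p : (Z.induce S hS).V → Prop} :
    (∃ v, p v) ↔ ∃ v, ∃ hv : v ∈ S, p ⟨v, hv⟩ := Subtype.exists

theorem forall_induce {S : Set Z.V} {hS : S.Nonempty} {p : (Z.induce S hS).V → Prop} :
    (∀ v, p v) ↔ ∀ v, ∀ hv : v ∈ S, p ⟨v, hv⟩ := Subtype.forall

theorem induce_adj {S : Set Z.V} {hS : S.Nonempty} {v w : Z.V} {hv : v ∈ S} {hw : w ∈ S} :
    (Z.induce S hS).Adj ⟨v, hv⟩ ⟨w, hw⟩ ↔ Z.Adj v w := Iff.rfl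

variable {v : Z.V}

theorem isFreeExt_induce_insert (hQ : ∀ x ∈ Q, ∀ y ∈ Q, Z.Adj x y) (hnt : Q.Nontrivial) :
    IsFreeExt (Z.induce (insert v Q) (Set.insert_nonempty _ _)) ↔ IsFreeAt Q v := by
  simp only [IsFreeExt, IsFreeAt, exists_induce, induce_adj, ne_eq]
  constructor
  · rintro ⟨⟨x, hx, q, hq, p, hp, h⟩, h'⟩
    grind
  · rintro ⟨h, p, hp, hvp⟩
    obtain ⟨q, hq, hqp⟩ := hnt.exists_ne p
    refine ⟨⟨v, .inl rfl, q, .inr hq, p, .inr hp,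
      fun h => hqp (congrArg Subtype.val h), hQ _ hq _ hp, hQ _ hp _ hq, h q hq, h p hp,
      hvp⟩, ?_⟩
    rintro ⟨x, hx, q, hq, p, hp, h⟩
    grind

theorem isJoinedExt_induce_insert (hQ : ∀ x ∈ Q, ∀ y ∈ Q, Z.Adj x y) :
    IsJoinedExt (Z.induce (insert v Q) (Set.insert_nonempty _ _)) ↔ IsJoinedAt Q v := by
  simp only [IsJoinedExt, IsJoinedAt, exists_induce, forall_induce, induce_adj, ne_eq]
  grind

end FinDigraph

namespace DefinableProp

open FinDigraph Sum

variable {α : Type} {T : FinDigraph → Prop}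

theorem isFull (i : α) : DefinableProp fun v => IsFull (v i) :=
  (exists_four (fun r _ => ¬r 0 1) i).not.congr fun v => by simp [IsFull]

theorem nontrivial (i : α) : DefinableProp fun v => Nontrivial (v i).V :=
  (exists_four (fun _ e => ¬e 0 1) i).congr fun v => by simp [nontrivial_iff]

theorem isFreeExt (i : α) : DefinableProp fun v => IsFreeExt (v i) :=
  ((exists_four (fun r e => ¬e 1 2 ∧ r 1 2 ∧ r 2 1 ∧ ¬r 1 0 ∧ ¬r 2 0 ∧ ¬r 0 2) i).and
    (exists_four (fun r e => ¬e 1 2 ∧ r 1 2 ∧ r 2 1 ∧ r 1 0 ∧ ¬r 2 0) i).not).congr fun v => by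
      simp [IsFreeExt]

theorem isJoinedExt (i : α) : DefinableProp fun v => IsJoinedExt (v i) :=
  ((exists_four (fun r _ => ¬r 0 0) i).and
    (exists_four (fun r e => ¬(¬r 0 0 → ¬e 0 1 → (r 1 0 ↔ ¬r 0 1))) i).not).congr fun v => by
      simp [IsJoinedExt]

theorem hasAdjJoinedPair (i : α) : DefinableProp fun v => HasAdjJoinedPair (v i) :=
  ((exists_four (fun r _ => ¬r 0 0 ∧ ¬r 1 1 ∧ r 0 1) i).and
    (exists_four (fun r _ => ¬(¬r 0 0 → r 1 1 → (r 1 0 ↔ ¬r 0 1))) i).not).congr fun v => by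
      simp [HasAdjJoinedPair]

theorem allCovers (hT : DefinableProp fun v : Unit → FinDigraph => T (v ())) (i j : α) :
    DefinableProp fun v => AllCovers T (v i) (v j) :=
  (le i j).and (all ((covBy (inl i) (inr ())).imp
    ((le (inr ()) (inl j)).imp (hT.comp fun _ => inr ()))))

theorem allCovers₂ (hT : DefinableProp fun v : Unit → FinDigraph => T (v ())) (i j : α) :
    DefinableProp fun v => AllCovers₂ T (v i) (v j) :=
  (le i j).and (all (all ((covBy (inl (inl i)) (inl (inr ()))).imp
    ((covBy (inl (inr ())) (inr ())).imp
      ((le (inr ()) (inl (inl j))).imp (hT.comp fun _ => inr ()))))))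

end DefinableProp

/-! ### Frames -/

namespace FinDigraph

variable {G H K L Z A B : FinDigraph} {Q R : Set Z.V}

/-- One half of a frame: the vertices of `Z` outside a copy of the full digraph `K` are free at
that copy or joined to it, and `A` is what is left when the joined ones are deleted. -/
def IsHalfFrame (K Z A : FinDigraph) : Prop :=
  IsFull K ∧ Nontrivial K.V ∧ AllCovers (fun W => IsFreeExt W ∨ IsJoinedExt W) K Z ∧
    AllCovers₂ (¬HasAdjJoinedPair ·) K Z ∧ IsGreatest {B | B ≤ Z ∧ AllCovers IsFreeExt K B} A

/-- `Z` consists of a full digraph `K`, an edgeless digraph and `G`, put together in such a way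
that `G` can be recovered; see `isFrame_iff`. -/
def IsFrame (K Z G : FinDigraph) : Prop :=
  ∃ E A B : FinDigraph, IsHalfFrame K Z A ∧ IsHalfFrame E.dual Z.dual B.dual ∧ IsGLB {A, B} G

/-- The vertices of a frame: a full set `Q` and an edgeless set `R` joined to one another, and
vertices that are free at both. -/
structure IsFrameOn (Q R : Set Z.V) : Prop where
  adj : ∀ x ∈ Q, ∀ y ∈ Q, Z.Adj x y
  not_adj : ∀ x ∈ R, ∀ y ∈ R, ¬Z.Adj x y
  nontrivial_left : Q.Nontrivial
  nontrivial_right : R.Nontrivial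
  joined : ∀ x ∈ Q, ∀ y ∈ R, Z.Adj x y ↔ ¬Z.Adj y x
  free_left : ∀ v ∉ Q, v ∉ R → IsFreeAt Q v
  free_right : ∀ v ∉ Q, v ∉ R → IsFreeAt (Z := Z.dual) R v

theorem forall_range_adj_iff {f : Emb K Z} :
    (∀ x ∈ Set.range f, ∀ y ∈ Set.range f, Z.Adj x y) ↔ IsFull K := by
  simp only [Set.forall_mem_range, f.map_rel_iff, IsFull]

theorem nontrivial_range_iff {f : Emb K Z} : (Set.range f).Nontrivial ↔ Nontrivial K.V := by
  rw [← Set.image_univ, Set.image_nontrivial f.injective, Set.nontrivial_univ_iff]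

theorem IsHalfFrame.forall_range_adj (h : IsHalfFrame K Z A) (f : Emb K Z) :
    ∀ x ∈ Set.range f, ∀ y ∈ Set.range f, Z.Adj x y :=
  forall_range_adj_iff.2 h.1

theorem IsHalfFrame.nontrivial_range (h : IsHalfFrame K Z A) (f : Emb K Z) :
    (Set.range f).Nontrivial :=
  nontrivial_range_iff.2 h.2.1

theorem IsHalfFrame.isFreeAt_or_isJoinedAt (h : IsHalfFrame K Z A) (f : Emb K Z) {v : Z.V}
    (hv : v ∉ Set.range f) : IsFreeAt (Set.range f) v ∨ IsJoinedAt (Set.range f) v := by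
  rw [← isFreeExt_induce_insert (h.forall_range_adj f) (h.nontrivial_range f),
    ← isJoinedExt_induce_insert (h.forall_range_adj f)]
  exact h.2.2.1.induce f hv

theorem IsHalfFrame.not_adj_of_isJoinedAt (h : IsHalfFrame K Z A) (f : Emb K Z) {v w : Z.V}
    (hv : IsJoinedAt (Set.range f) v) (hw : IsJoinedAt (Set.range f) w) : ¬Z.Adj v w := by
  intro hvw
  have full := h.forall_range_adj f
  have hvf : v ∉ Set.range f := fun hv' => hv.1 (full _ hv' _ hv')
  have hwf : w ∉ insert v (Set.range f) := by
    rintro (rfl | hw')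
    exacts [hv.1 hvw, hw.1 (full _ hw' _ hw')]
  refine h.2.2.2.1.induce f hvf hwf ?_
  simp only [IsJoinedAt] at hv hw
  simp only [HasAdjJoinedPair, exists_induce, forall_induce, induce_adj]
  grind

theorem IsHalfFrame.isJoinedAt (hK : IsHalfFrame K Z A) (hL : IsHalfFrame L Z.dual B)
    (f : Emb K Z) (e : Emb L Z.dual) {y : Z.V} (hy : y ∈ Set.range e) :
    IsJoinedAt (Set.range f) y := by
  have full := hK.forall_range_adj f
  have edgeless := hL.forall_range_adj e
  have hyf : y ∉ Set.range f := fun hy' => edgeless _ hy _ hy (full _ hy' _ hy')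
  refine (hK.isFreeAt_or_isJoinedAt f hyf).resolve_left fun ⟨not_adj, x, hx, hyx⟩ => ?_
  have hxe : x ∉ Set.range e := fun hx' => edgeless _ hx' _ hx' (full _ hx _ hx)
  obtain hfree | hjoin := hL.isFreeAt_or_isJoinedAt e hxe
  · exact hfree.1 y hy (not_adj x hx)
  · exact not_adj x hx (by_contra fun h => ((hjoin.2 y hy).1 h) hyx)

theorem IsHalfFrame.isFreeAt (hK : IsHalfFrame K Z A) (hL : IsHalfFrame L Z.dual B)
    (f : Emb K Z) (e : Emb L Z.dual) {v : Z.V} (hvf : v ∉ Set.range f) (hve : v ∉ Set.range e) :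
    IsFreeAt (Set.range f) v := by
  refine (hK.isFreeAt_or_isJoinedAt f hvf).resolve_right fun hv => ?_
  obtain ⟨y, hy⟩ := Set.range_nonempty e
  obtain hfree | hjoin := hL.isFreeAt_or_isJoinedAt e hve
  · exact hK.not_adj_of_isJoinedAt f hv (hK.isJoinedAt hL f e hy)
      (not_not.1 (hfree.1 y hy))
  · exact hjoin.1 hv.1

theorem IsHalfFrame.isFrameOn (hK : IsHalfFrame K Z A) (hL : IsHalfFrame L Z.dual B)
    (f : Emb K Z) (e : Emb L Z.dual) : IsFrameOn (Z := Z) (Set.range f) (Set.range e) := by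
  have hK' : IsHalfFrame K Z.dual.dual A := Z.dual_dual.symm ▸ hK
  let f' : Emb K Z.dual.dual := ⟨f.toEmbedding, not_not.trans f.map_rel_iff⟩
  exact {
    adj := hK.forall_range_adj f
    not_adj := fun x hx y hy => hL.forall_range_adj e y hy x hx
    nontrivial_left := hK.nontrivial_range f
    nontrivial_right := hL.nontrivial_range e
    joined := fun x hx y hy => (hK.isJoinedAt hL f e hy).2 x hx
    free_left := fun v hvf hve => hK.isFreeAt hL f e hvf hve
    free_right := fun v hvf hve => hL.isFreeAt hK' e f' hve hvf }

namespace IsFrameOn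

theorem dual (h : IsFrameOn Q R) : IsFrameOn (Z := Z.dual) R Q where
  adj := fun x hx y hy => h.not_adj y hy x hx
  not_adj := fun x hx y hy => not_not.2 (h.adj y hy x hx)
  nontrivial_left := h.nontrivial_right
  nontrivial_right := h.nontrivial_left
  joined := fun x hx y hy => not_congr (h.joined y hy x hx)
  free_left := fun v hR hQ => h.free_right v hQ hR
  free_right := fun v hR hQ => by
    simpa only [IsFreeAt, Adj, FinDigraph.dual, not_not] using h.free_left v hQ hR

theorem notMem_right (h : IsFrameOn Q R) {x : Z.V} (hx : x ∈ Q) : x ∉ R :=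
  fun hx' => h.not_adj x hx' x hx' (h.adj x hx x hx)

theorem subset_left (h : IsFrameOn Q R) {Q' : Set Z.V} (h' : IsFrameOn Q' R) : Q' ⊆ Q := by
  intro x hx
  by_contra hxQ
  obtain ⟨hfree, y, hy, hxy⟩ := h.free_right x hxQ (h'.notMem_right hx)
  exact (h'.joined x hx y hy).1 (not_not.1 (hfree y hy)) (not_not.1 hxy)

theorem exists_emb_compl_union (h : IsFrameOn Q R) (f : Emb H Z) (hf : Set.range f ⊆ Rᶜ)
    (g : Emb H Z) (hg : Set.range g ⊆ Qᶜ) : ∃ k : Emb H Z, Set.range k ⊆ (Q ∪ R)ᶜ := by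
  rw [Set.range_subset_iff] at hf hg
  by_cases hfQ : ∀ x, f x ∉ Q
  · exact ⟨f, Set.range_subset_iff.2 fun x => not_or.2 ⟨hfQ x, hf x⟩⟩
  by_cases hgR : ∀ y, g y ∉ R
  · exact ⟨g, Set.range_subset_iff.2 fun y => not_or.2 ⟨hg y, hgR y⟩⟩
  push Not at hfQ hgR
  obtain ⟨⟨x, hx⟩, ⟨y, hy⟩⟩ := hfQ, hgR
  have hxx : H.Adj x x := f.map_rel_iff.1 (h.adj _ hx _ hx)
  have hyy : ¬H.Adj y y := mt g.map_rel_iff.2 (h.not_adj _ hy _ hy)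
  have hfy : f y ∉ Q := fun hy' => hyy (f.map_rel_iff.1 (h.adj _ hy' _ hy'))
  have hgx : g x ∉ R := fun hx' => h.not_adj _ hx' _ hx' (g.map_rel_iff.2 hxx)
  have hxy : ¬H.Adj x y := mt f.map_rel_iff.2 ((h.free_left _ hfy (hf y)).1 _ hx)
  exact (((h.free_right _ (hg x) hgx).1 _ hy) (mt g.map_rel_iff.1 hxy)).elim

theorem isGreatest_induce (h : IsFrameOn Q R) (hK : IsOnlyCopy K Q) (hS : Rᶜ.Nonempty) :
    IsGreatest {B | B ≤ Z ∧ AllCovers IsFreeExt K B} (Z.induce Rᶜ hS) := by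
  refine ⟨⟨induce_le _ _, (hK.allCovers_induce_iff (fun _ => h.notMem_right)
    (DefinableProp.isFreeExt ())).2 fun v hvR hv => ?_⟩, fun B ⟨hBZ, hB⟩ => ?_⟩
  · exact (isFreeExt_induce_insert h.adj h.nontrivial_left).2 (h.free_left v hv hvR)
  · obtain ⟨g⟩ := le_iff_nonempty_emb.1 hBZ
    obtain ⟨k⟩ := le_iff_nonempty_emb.1 hB.1
    obtain rfl := hK.2 (k.trans g)
    refine le_induce_iff.2 ⟨g, Set.range_subset_iff.2 fun b hb => ?_⟩
    have hbk : b ∉ Set.range k := by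
      rintro ⟨x, rfl⟩
      exact h.notMem_right ⟨x, rfl⟩ hb
    obtain ⟨hnot, _, ⟨x, rfl⟩, hbx⟩ :=
      (isFreeExt_induce_insert (forall_range_adj_iff.2 (forall_range_adj_iff.1 h.adj))
        (nontrivial_range_iff.2 (nontrivial_range_iff.1 h.nontrivial_left))).1 (hB.induce k hbk)
    have hxb : ¬Z.Adj (g (k x)) (g b) := mt g.map_rel_iff.1 (hnot _ ⟨x, rfl⟩)
    exact hxb ((h.joined _ ⟨x, rfl⟩ _ hb).2 (mt g.map_rel_iff.1 hbx))

theorem isHalfFrame (h : IsFrameOn Q R) (hK : IsOnlyCopy K Q) (hS : Rᶜ.Nonempty) :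
    IsHalfFrame K Z (Z.induce Rᶜ hS) := by
  obtain ⟨f, rfl⟩ := hK.exists_emb
  refine ⟨forall_range_adj_iff.1 h.adj, nontrivial_range_iff.1 h.nontrivial_left, ?_, ?_,
    h.isGreatest_induce hK hS⟩
  · rw [hK.allCovers_iff ((DefinableProp.isFreeExt ()).or (DefinableProp.isJoinedExt ()))]
    intro v hv
    rw [isFreeExt_induce_insert h.adj h.nontrivial_left, isJoinedExt_induce_insert h.adj]
    by_cases hvR : v ∈ R
    · exact .inr ⟨h.not_adj v hvR v hvR, fun x hx => h.joined x hx v hvR⟩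
    · exact .inl (h.free_left v hv hvR)
  · rw [hK.allCovers₂_iff (DefinableProp.hasAdjJoinedPair ()).not]
    intro v _ w _
    simp only [HasAdjJoinedPair, exists_induce, forall_induce, induce_adj]
    rintro ⟨⟨x, hx, y, hy, hxx, hyy, hxy⟩, hjoin⟩
    have mem_right : ∀ z ∈ insert w (insert v (Set.range f)), ¬Z.Adj z z → z ∈ R := by
      intro z hz hzz
      by_contra hzR
      obtain ⟨hin, q, hq, hout⟩ := h.free_left z (fun hzQ => hzz (h.adj z hzQ z hzQ)) hzR
      exact hin q hq ((hjoin z hz hzz q (.inr (.inr hq)) (h.adj q hq q hq)).2 hout)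
    exact h.not_adj x (mem_right x hx hxx) y (mem_right y hy hyy) hxy

theorem isGLB_iff (h : IsFrameOn Q R) {hR : Rᶜ.Nonempty} {hQ : Qᶜ.Nonempty}
    (hA : A ≈ Z.induce Rᶜ hR) (hB : B ≈ Z.induce Qᶜ hQ) :
    IsGLB {A, B} G ↔ ∃ i : Emb G Z, Set.range i = (Q ∪ R)ᶜ := by
  have le_and_le_iff (H : FinDigraph) : H ≤ A ∧ H ≤ B ↔ ∃ f : Emb H Z, Set.range f ⊆ (Q ∪ R)ᶜ := by
    have le_left : H ≤ A ↔ H ≤ Z.induce Rᶜ hR :=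
      ⟨(·.trans (le_of_equiv hA)), (·.trans (le_of_equiv (Setoid.symm hA)))⟩
    have le_right : H ≤ B ↔ H ≤ Z.induce Qᶜ hQ :=
      ⟨(·.trans (le_of_equiv hB)), (·.trans (le_of_equiv (Setoid.symm hB)))⟩
    rw [le_left, le_right, le_induce_iff, le_induce_iff, Set.compl_union]
    exact ⟨fun ⟨⟨f, hf⟩, ⟨g, hg⟩⟩ => Set.compl_union Q R ▸ h.exists_emb_compl_union f hf g hg,
      fun ⟨f, hf⟩ => ⟨⟨f, hf.trans Set.inter_subset_right⟩, ⟨f, hf.trans Set.inter_subset_left⟩⟩⟩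
  simp only [isGLB_iff_le_iff, lowerBounds_insert, lowerBounds_singleton, Set.mem_inter_iff,
    Set.mem_Iic, le_and_le_iff]
  constructor
  · intro hG
    obtain ⟨i, hi⟩ := (hG G).1 le_rfl
    refine ⟨i, Set.eq_of_subset_of_ncard_le hi ?_⟩
    have hC : (Q ∪ R)ᶜ.Nonempty := (Set.range_nonempty i).mono hi
    rw [ncard_range, ← card_induce _ hC]
    exact card_le_of_le ((hG _).2 (le_induce_iff.1 le_rfl))
  · rintro ⟨i, hi⟩ H
    rw [← hi, ← le_induce_iff (hS := Set.range_nonempty i)]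
    exact ⟨(·.trans (le_of_equiv (equiv_induce_range i))),
      (·.trans (le_of_equiv (Setoid.symm (equiv_induce_range i))))⟩

theorem nonempty_compl_right (h : IsFrameOn Q R) : Rᶜ.Nonempty :=
  h.nontrivial_left.nonempty.mono fun _ => h.notMem_right

end IsFrameOn

namespace IsHalfFrame

theorem isOnlyCopy_left (hK : IsHalfFrame K Z A) (hL : IsHalfFrame L Z.dual B)
    (f : Emb K Z) (e : Emb L Z.dual) : IsOnlyCopy K (Set.range f) :=
  ⟨f.le, fun f' => ((hK.isFrameOn hL f e).subset_left (hK.isFrameOn hL f' e)).antisymm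
    ((hK.isFrameOn hL f' e).subset_left (hK.isFrameOn hL f e))⟩

theorem isOnlyCopy_right (hK : IsHalfFrame K Z A) (hL : IsHalfFrame L Z.dual B)
    (f : Emb K Z) (e : Emb L Z.dual) : IsOnlyCopy L (Set.range e) :=
  ⟨e.le, fun e' =>
    ((hK.isFrameOn hL f e).dual.subset_left (hK.isFrameOn hL f e').dual).antisymm
      ((hK.isFrameOn hL f e').dual.subset_left (hK.isFrameOn hL f e).dual)⟩

theorem equiv_induce (hK : IsHalfFrame K Z A) (h : IsFrameOn Q R) (hQ : IsOnlyCopy K Q)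
    (hR : Rᶜ.Nonempty) : A ≈ Z.induce Rᶜ hR :=
  have hA := hK.2.2.2.2
  have hA' := h.isGreatest_induce hQ hR
  equiv_of_le_of_ge (hA'.2 hA.1) (hA.2 hA'.1)

end IsHalfFrame

theorem isFrame_iff : IsFrame K Z G ↔ ∃ L : FinDigraph, ∃ Q R : Set Z.V, ∃ i : Emb G Z,
    IsFrameOn Q R ∧ IsOnlyCopy K Q ∧ IsOnlyCopy (Z := Z.dual) L R ∧ Set.range i = (Q ∪ R)ᶜ := by
  constructor
  · rintro ⟨E, A, B, hK, hL, hG⟩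
    obtain ⟨f⟩ := le_iff_nonempty_emb.1 hK.2.2.1.1
    obtain ⟨e⟩ := le_iff_nonempty_emb.1 hL.2.2.1.1
    have h := hK.isFrameOn hL f e
    have hQ := hK.isOnlyCopy_left hL f e
    have hR := hK.isOnlyCopy_right hL f e
    have hA := hK.equiv_induce h hQ h.nonempty_compl_right
    have hB := hL.equiv_induce h.dual hR h.dual.nonempty_compl_right
    have hB' : B ≈ Z.induce (Set.range f)ᶜ h.dual.nonempty_compl_right :=
      equiv_of_le_of_ge (dual_le_dual_iff.1 (le_of_equiv hB))
        (dual_le_dual_iff.1 (le_of_equiv (Setoid.symm hB)))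
    obtain ⟨i, hi⟩ := (h.isGLB_iff hA hB').1 hG
    exact ⟨E.dual, _, _, i, h, hQ, hR, hi⟩
  · rintro ⟨L, Q, R, i, h, hQ, hR, hi⟩
    refine ⟨L.dual, Z.induce Rᶜ h.nonempty_compl_right, Z.induce Qᶜ h.dual.nonempty_compl_right,
      h.isHalfFrame hQ h.nonempty_compl_right, ?_,
      (h.isGLB_iff (Setoid.refl _) (Setoid.refl _)).2 ⟨i, hi⟩⟩
    rw [dual_dual]
    exact h.dual.isHalfFrame hR h.dual.nonempty_compl_right

theorem IsFrameOn.isOnlyCopy (h : IsFrameOn Q R) (f : Emb K Z) (hf : Set.range f = Q)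
    (hcard : (Q ∪ R)ᶜ.ncard < Q.ncard) : IsOnlyCopy K Q := by
  refine ⟨f.le, fun g => ?_⟩
  subst hf
  have full : ∀ x ∈ Set.range g, ∀ y ∈ Set.range g, Z.Adj x y :=
    forall_range_adj_iff.2 (forall_range_adj_iff.1 h.adj)
  have notMem_right {x : Z.V} (hx : x ∈ Set.range g) : x ∉ R :=
    fun hxR => h.not_adj x hxR x hxR (full x hx x hx)
  have hcard' : (Set.range g).ncard = (Set.range f).ncard := by rw [ncard_range, ncard_range]
  obtain ⟨q, hq, hqQ⟩ : ∃ q ∈ Set.range g, q ∈ Set.range f := by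
    by_contra! hg
    exact hcard.not_ge (hcard' ▸ Set.ncard_le_ncard fun x hx =>
      not_or.2 ⟨hg x hx, notMem_right hx⟩)
  refine Set.eq_of_subset_of_ncard_le (fun x hx => by_contra fun hxQ => ?_) hcard'.ge
  exact (h.free_left x hxQ (notMem_right hx)).1 q hqQ (full q hq x hx)

end FinDigraph

namespace DefinableProp

open FinDigraph Sum

variable {α : Type}

theorem isHalfFrame (i j k : α) : DefinableProp fun v => IsHalfFrame (v i) (v j) (v k) :=
  (isFull i).and <| (nontrivial i).and <|
    (allCovers ((isFreeExt ()).or (isJoinedExt ())) i j).and <|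
    (allCovers₂ (hasAdjJoinedPair ()).not i j).and <|
    ((le k j).and (allCovers (isFreeExt ()) i k)).and <|
    all (((le (inr ()) (inl j)).and (allCovers (isFreeExt ()) (inl i) (inr ()))).imp
      (le (inr ()) (inl k)))

theorem isFrame (i j k : α) : DefinableProp fun v => IsFrame (v i) (v j) (v k) :=
  ex <| ex <| ex <| (isHalfFrame (inl (inl (inl i))) (inl (inl (inl j))) (inl (inr ()))).and <|
    (isHalfFrame (inl (inl (inr ()))) (inl (inl (inl j))) (inr ())).dual.and <|
    isGLB_pair (inl (inr ())) (inr ()) (inl (inl (inl k)))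

end DefinableProp

/-! ### Scales and numbers -/

namespace FinDigraph

variable {C K W X Y Z Z' : FinDigraph} {Q S : Set Z.V} {Q' : Set Z'.V} {v w : Z.V} {v' : Z'.V}

/-- A full set of at least two vertices that is the only copy of `K`. The vertices that are free at
a scale are told apart by their out-neighbours in it. -/
structure IsScale (K : FinDigraph) (Q : Set Z.V) : Prop where
  isOnlyCopy : IsOnlyCopy K Q
  adj : ∀ x ∈ Q, ∀ y ∈ Q, Z.Adj x y
  nontrivial : Q.Nontrivial

/-- The set of out-neighbours of `v` in `Q`. -/
def outNbrs (Q : Set Z.V) (v : Z.V) : Set Z.V := {q ∈ Q | Z.Adj v q}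

/-- The number of a vertex on the scale `Q`. -/
noncomputable def number (Q : Set Z.V) (v : Z.V) : ℕ := (outNbrs Q v).ncard

/-- The vertices that are free at `Q` are linearly ordered by their out-neighbours in `Q`. -/
def IsNumberedOn (Q : Set Z.V) : Prop :=
  ∀ v, IsFreeAt Q v → ∀ w, IsFreeAt Q w → v ≠ w →
    outNbrs Q v ⊂ outNbrs Q w ∨ outNbrs Q w ⊂ outNbrs Q v

theorem IsNumberedOn.not_subset_iff (h : IsNumberedOn Q) (hv : IsFreeAt Q v) (hw : IsFreeAt Q w)
    (hvw : v ≠ w) : ¬outNbrs Q w ⊆ outNbrs Q v ↔ number Q v < number Q w := by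
  constructor
  · intro hsub
    exact Set.ncard_lt_ncard ((h v hv w hw hvw).resolve_right fun hwv => hsub hwv.subset)
  · intro hlt hsub
    exact hlt.not_ge (Set.ncard_le_ncard hsub)

theorem IsNumberedOn.number_inj (h : IsNumberedOn Q) (hv : IsFreeAt Q v) (hw : IsFreeAt Q w) :
    number Q v = number Q w ↔ v = w := by
  refine ⟨fun heq => by_contra fun hvw => ?_, fun heq => heq ▸ rfl⟩
  rcases h v hv w hw hvw with hlt | hlt
  · exact (Set.ncard_lt_ncard hlt).ne heq
  · exact (Set.ncard_lt_ncard hlt).ne' heq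

/-- There is an edge whose reverse is not an edge, and any two distinct vertices are adjacent. -/
def IsPointed (Y : FinDigraph) : Prop :=
  (∃ x y, Y.Adj x y ∧ ¬Y.Adj y x) ∧ ∀ x y, x ≠ y → Y.Adj x y ∨ Y.Adj y x

/-- If `W` consists of a scale and a vertex that is free at it, this says that `C` is full and has
at most as many vertices as the number of that vertex: `Y` is spanned by the vertex and as many of
its out-neighbours as `C` has vertices. -/
def NumberGE (W C : FinDigraph) : Prop :=
  IsFull C ∧ ∃ Y, C ⋖ Y ∧ Y ≤ W ∧ IsPointed Y

/-- If `W` and `Y` each consist of a scale and a vertex that is free at it, this says that the two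
vertices have the same number. -/
def SameNumber (W Y : FinDigraph) : Prop :=
  ∀ C, NumberGE W C ↔ NumberGE Y C

theorem range_subset_insert_outNbrs (hQ : ∀ x ∈ Q, ∀ y ∈ Q, Z.Adj x y) (hv : IsFreeAt Q v)
    (hY : IsPointed Y) {g : Emb Y Z} (hg : Set.range g ⊆ insert v Q) :
    Set.range g ⊆ insert v (outNbrs Q v) := by
  obtain ⟨⟨x, y, hxy, hyx⟩, hsemi⟩ := hY
  have hmem (u : Y.V) : g u = v ∨ g u ∈ Q := hg ⟨u, rfl⟩
  rw [← g.map_rel_iff] at hxy hyx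
  have hx : g x = v := by
    have := hv.1
    grind
  rintro _ ⟨u, rfl⟩
  refine (hmem u).imp_right fun hu => ⟨hu, ?_⟩
  by_cases hxu : x = u
  · exact absurd (hQ _ hu _ (hxu ▸ hu)) (hx ▸ hv.1 _ hu)
  · rcases hsemi x u hxu with h | h <;> rw [← g.map_rel_iff, hx] at h
    · exact h
    · exact absurd h (hv.1 _ hu)

theorem equiv_induce_of_isFull (hC : IsFull C) {hS : S.Nonempty}
    (hadj : ∀ x ∈ S, ∀ y ∈ S, Z.Adj x y) (hcard : S.ncard = Nat.card C.V) :
    C ≈ Z.induce S hS := by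
  let e : C.V ≃ S := (Finite.card_eq.1 (hcard.symm.trans (Nat.card_coe_set_eq S).symm)).some
  exact ⟨⟨e, iff_of_true (hadj _ (e _).2 _ (e _).2) (hC _ _)⟩⟩

theorem numberGE_iff (hQ : ∀ x ∈ Q, ∀ y ∈ Q, Z.Adj x y) (hv : IsFreeAt Q v) :
    NumberGE (Z.induce (insert v Q) (Set.insert_nonempty _ _)) C ↔
      IsFull C ∧ Nat.card C.V ≤ number Q v := by
  refine and_congr_right fun hC => ⟨?_, fun hcard => ?_⟩
  · rintro ⟨Y, hCY, hYZ, hY⟩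
    obtain ⟨g, hg⟩ := le_induce_iff.1 hYZ
    have hle := Set.ncard_le_ncard (range_subset_insert_outNbrs hQ hv hY hg)
    rw [ncard_range, (covBy_iff_card.1 hCY).2] at hle
    exact Nat.le_of_lt_succ (hle.trans (Set.ncard_insert_le _ _))
  · obtain ⟨S, hS, hSC⟩ := Set.exists_subset_card_eq hcard
    have hne : S.Nonempty := (Set.ncard_pos (Set.toFinite S)).1 (hSC ▸ Nat.card_pos)
    have hSQ (x) (hx : x ∈ S) : x ∈ Q := (hS hx).1
    have hadj : ∀ x ∈ S, ∀ y ∈ S, Z.Adj x y := fun x hx y hy => hQ x (hSQ x hx) y (hSQ y hy)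
    have hvS : v ∉ S := fun h => hv.1 v (hSQ v h) (hadj v h v h)
    refine ⟨Z.induce (insert v S) (Set.insert_nonempty _ _), ?_,
      induce_mono (Set.insert_subset_insert hSQ), ?_, ?_⟩
    · exact (covBy_congr (equiv_induce_of_isFull hC (hS := hne) hadj hSC) (Setoid.refl _)).2
        (induce_covBy_induce_insert hvS)
    · obtain ⟨q, hq⟩ := hne
      exact ⟨⟨v, .inl rfl⟩, ⟨q, .inr hq⟩, (hS hq).2, hv.1 q (hSQ q hq)⟩
    · rintro ⟨x, rfl | hx⟩ ⟨y, rfl | hy⟩ hxy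
      · exact absurd rfl hxy
      · exact .inl (hS hy).2
      · exact .inr (hS hx).2
      · exact .inl (hadj x hx y hy)

/-- The full digraph with `n + 1` vertices. -/
def fullDigraph (n : ℕ) : FinDigraph := ⟨Fin (n + 1), ⟨fun _ _ => True⟩⟩

theorem ncard_range_fullDigraph {n : ℕ} (f : Emb (fullDigraph n) Z) :
    (Set.range f).ncard = n + 1 :=
  (ncard_range f).trans (Nat.card_fin _)

theorem sameNumber_induce_iff (hQ : ∀ x ∈ Q, ∀ y ∈ Q, Z.Adj x y)
    (hQ' : ∀ x ∈ Q', ∀ y ∈ Q', Z'.Adj x y) (hv : IsFreeAt Q v) (hv' : IsFreeAt Q' v') :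
    SameNumber (Z.induce (insert v Q) (Set.insert_nonempty _ _))
      (Z'.induce (insert v' Q') (Set.insert_nonempty _ _)) ↔ number Q v = number Q' v' := by
  simp only [SameNumber, numberGE_iff hQ hv, numberGE_iff hQ' hv']
  refine ⟨fun h => ?_, fun h C => by rw [h]⟩
  have hsucc (n : ℕ) : n + 1 ≤ number Q v ↔ n + 1 ≤ number Q' v' := by
    have hcard : Nat.card (fullDigraph n).V = n + 1 := Nat.card_fin _
    have hfull : IsFull (fullDigraph n) := fun _ _ => trivial
    simpa only [hcard, hfull, true_and] using h (fullDigraph n)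
  have := hsucc (number Q v - 1)
  have := hsucc (number Q' v' - 1)
  omega

/-- Outside the scale of `X` there are a vertex `x` and a vertex `y` with an out-neighbour in the
scale that is not one of `x`, and `c` holds for the edges from `x` to `y` and from `y` to `x`. -/
def HasSeparatedPair (c : Prop → Prop → Prop) (X : FinDigraph) : Prop :=
  ∃ x y q p, q ≠ p ∧ X.Adj q p ∧ X.Adj p q ∧ X.Adj y q ∧ ¬X.Adj q y ∧ ¬X.Adj x q ∧
    c (X.Adj x y) (X.Adj y x)

/-- Two vertices outside the scale of `X` have incomparable sets of out-neighbours in it. -/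
def HasCrossing (X : FinDigraph) : Prop :=
  ∃ x y q p, X.Adj q p ∧ X.Adj p q ∧ X.Adj x q ∧ ¬X.Adj q x ∧ ¬X.Adj x p ∧
    X.Adj y p ∧ ¬X.Adj p y ∧ ¬X.Adj y q

/-- `W` is spanned in `Z` by the scale `K` and one vertex that is free at it. -/
def IsFreeVertex (K Z W : FinDigraph) : Prop := (K ⋖ W ∧ W ≤ Z) ∧ IsFreeExt W

/-- `X` is spanned in `Z` by the scale `K` and two vertices that are free at it. -/
def IsFreePair (K Z X : FinDigraph) : Prop :=
  (∃ W, K ⋖ W ∧ W ⋖ X ∧ X ≤ Z) ∧ AllCovers IsFreeExt K X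

/-- The vertices that are free at the scale `K` are linearly ordered by their out-neighbours. -/
def IsNumbered (K Z : FinDigraph) : Prop :=
  ∀ X, IsFreePair K Z X → HasSeparatedPair (fun _ _ => True) X ∧ ¬HasCrossing X

/-- Every vertex has a loop. -/
def IsReflexive (W : FinDigraph) : Prop := ∀ x, W.Adj x x

/-- The free vertices of `X` at the scale `K` have numbers that also occur in `T`. -/
def SameNumbers (K X T : FinDigraph) : Prop :=
  ∀ W, K ⋖ W ∧ W ≤ X → ∃ Y, (K ⋖ Y ∧ Y ≤ T) ∧ SameNumber W Y

/-- Sending each vertex of `Z` that is free at the scale `K` to the one of `Z'` with the same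
number is a homomorphism. Edges between distinct vertices are compared in pairs, and
`HasSeparatedPair` expresses that the edge goes to the larger or to the smaller number. -/
def NumberLE (K Z Z' : FinDigraph) : Prop :=
  (∀ W, IsFreeVertex K Z W → ∃ Y, IsFreeVertex K Z' Y ∧ SameNumber W Y ∧
    (IsReflexive W → IsReflexive Y)) ∧
  ∀ X T, IsFreePair K Z X → IsFreePair K Z' T → SameNumbers K X T →
    (HasSeparatedPair (fun e _ => e) X → HasSeparatedPair (fun e _ => e) T) ∧
    (HasSeparatedPair (fun _ e => e) X → HasSeparatedPair (fun _ e => e) T)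

theorem not_outNbrs_subset_iff : ¬outNbrs Q v ⊆ outNbrs Q w ↔ ∃ q ∈ Q, Z.Adj v q ∧ ¬Z.Adj w q := by
  simp only [Set.not_subset, outNbrs, Set.mem_ofPred_eq, not_and, and_assoc]
  grind

namespace IsScale

theorem notMem (h : IsScale K Q) (hv : IsFreeAt Q v) : v ∉ Q :=
  fun hvQ => hv.1 v hvQ (h.adj v hvQ v hvQ)

theorem isFreeVertex_iff (h : IsScale K Q) : IsFreeVertex K Z W ↔
    ∃ v, IsFreeAt Q v ∧ W ≈ Z.induce (insert v Q) (Set.insert_nonempty _ _) := by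
  have isFreeExt_iff {v : Z.V} (hW : W ≈ Z.induce (insert v Q) (Set.insert_nonempty _ _)) :
      IsFreeExt W ↔ IsFreeAt Q v :=
    ((DefinableProp.isFreeExt ()).equiv_iff fun _ => hW).trans
      (isFreeExt_induce_insert h.adj h.nontrivial)
  rw [IsFreeVertex, h.isOnlyCopy.covBy_and_le_iff]
  constructor
  · rintro ⟨⟨v, -, hW⟩, hfree⟩
    exact ⟨v, (isFreeExt_iff hW).1 hfree, hW⟩
  · rintro ⟨v, hv, hW⟩
    exact ⟨⟨v, h.notMem hv, hW⟩, (isFreeExt_iff hW).2 hv⟩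

theorem allCovers_isFreeExt_iff (h : IsScale K Q) (hv : v ∉ Q) (hw : w ∉ Q) :
    AllCovers IsFreeExt K (Z.induce (insert w (insert v Q)) (Set.insert_nonempty _ _)) ↔
      IsFreeAt Q v ∧ IsFreeAt Q w := by
  rw [h.isOnlyCopy.allCovers_induce_iff
    ((Set.subset_insert _ _).trans (Set.subset_insert _ _)) (DefinableProp.isFreeExt ())]
  simp only [isFreeExt_induce_insert h.adj h.nontrivial, Set.mem_insert_iff]
  grind

theorem isFreePair_iff (h : IsScale K Q) : IsFreePair K Z X ↔
    ∃ v w, IsFreeAt Q v ∧ IsFreeAt Q w ∧ v ≠ w ∧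
      X ≈ Z.induce (insert w (insert v Q)) (Set.insert_nonempty _ _) := by
  have allCovers_iff {v w : Z.V} (hv : v ∉ Q) (hw : w ∉ Q)
      (hX : X ≈ Z.induce (insert w (insert v Q)) (Set.insert_nonempty _ _)) :
      AllCovers IsFreeExt K X ↔ IsFreeAt Q v ∧ IsFreeAt Q w :=
    ((DefinableProp.allCovers (DefinableProp.isFreeExt ()) false true).equiv_iff
      (v := fun b => cond b X K) (w := fun b => cond b _ K)
      (Bool.rec (Setoid.refl K) hX)).trans (h.allCovers_isFreeExt_iff hv hw)
  rw [IsFreePair, h.isOnlyCopy.covBy_covBy_and_le_iff]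
  constructor
  · rintro ⟨⟨v, hv, w, hw, hX⟩, hfree⟩
    rw [Set.mem_insert_iff, not_or] at hw
    obtain ⟨hv', hw'⟩ := (allCovers_iff hv hw.2 hX).1 hfree
    exact ⟨v, w, hv', hw', Ne.symm hw.1, hX⟩
  · rintro ⟨v, w, hv, hw, hvw, hX⟩
    have hwv : w ∉ insert v Q := by
      rw [Set.mem_insert_iff, not_or]
      exact ⟨hvw.symm, h.notMem hw⟩
    exact ⟨⟨v, h.notMem hv, w, hwv, hX⟩,
      (allCovers_iff (h.notMem hv) (h.notMem hw) hX).2 ⟨hv, hw⟩⟩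

theorem hasSeparatedPair_induce_iff (h : IsScale K Q) (c : Prop → Prop → Prop)
    (hv : IsFreeAt Q v) (hw : IsFreeAt Q w) :
    HasSeparatedPair c (Z.induce (insert w (insert v Q)) (Set.insert_nonempty _ _)) ↔
      (¬outNbrs Q w ⊆ outNbrs Q v ∧ c (Z.Adj v w) (Z.Adj w v)) ∨
        (¬outNbrs Q v ⊆ outNbrs Q w ∧ c (Z.Adj w v) (Z.Adj v w)) := by
  have exists_ne (q : Z.V) : ∃ p ∈ Q, p ≠ q := h.nontrivial.exists_ne q
  have hadj := h.adj
  have hv' := hv.1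
  have hw' := hw.1
  simp only [HasSeparatedPair, exists_induce, induce_adj, not_outNbrs_subset_iff, ne_eq,
    Set.mem_insert_iff]
  constructor
  · rintro ⟨x, hx, y, hy, q, hq, p, hp, hqp, hqp', hpq, hyq, hqy, hxq, hc⟩
    have hqQ : q ∈ Q := by grind
    grind
  · rintro (⟨⟨q, hq, hwq, hvq⟩, hc⟩ | ⟨⟨q, hq, hvq, hwq⟩, hc⟩) <;>
      obtain ⟨p, hp, hpq⟩ := exists_ne q
    · exact ⟨v, by simp, w, by simp, q, by simp [hq], p, by simp [hp],
        fun h => hpq (congrArg Subtype.val h).symm, hadj q hq p hp, hadj p hp q hq,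
        hwq, hw' q hq, hvq, hc⟩
    · exact ⟨w, by simp, v, by simp, q, by simp [hq], p, by simp [hp],
        fun h => hpq (congrArg Subtype.val h).symm, hadj q hq p hp, hadj p hp q hq,
        hvq, hv' q hq, hwq, hc⟩

theorem hasCrossing_induce_iff (h : IsScale K Q) (hv : IsFreeAt Q v) (hw : IsFreeAt Q w) :
    HasCrossing (Z.induce (insert w (insert v Q)) (Set.insert_nonempty _ _)) ↔
      ¬outNbrs Q v ⊆ outNbrs Q w ∧ ¬outNbrs Q w ⊆ outNbrs Q v := by
  have hadj := h.adj
  have hv' := hv.1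
  have hw' := hw.1
  simp only [HasCrossing, exists_induce, induce_adj, not_outNbrs_subset_iff, Set.mem_insert_iff]
  constructor
  · rintro ⟨x, hx, y, hy, q, hq, p, hp, hqp, hpq, hxq, hqx, hxp, hyp, hpy, hyq⟩
    have hqQ : q ∈ Q := by grind
    grind
  · rintro ⟨⟨q, hq, hvq, hwq⟩, p, hp, hwp, hvp⟩
    exact ⟨v, by simp, w, by simp, q, by simp [hq], p, by simp [hp], hadj q hq p hp,
      hadj p hp q hq, hvq, hv' q hq, hvp, hwp, hw' p hp, hwq⟩

end IsScale

end FinDigraph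

namespace DefinableProp

open FinDigraph Sum

variable {α : Type}

theorem hasSeparatedPair (c : Prop → Prop → Prop) (i : α) :
    DefinableProp fun v => HasSeparatedPair c (v i) :=
  (exists_four (fun r e => ¬e 2 3 ∧ r 2 3 ∧ r 3 2 ∧ r 1 2 ∧ ¬r 2 1 ∧ ¬r 0 2 ∧
    c (r 0 1) (r 1 0)) i).congr fun v => by simp [HasSeparatedPair]

theorem hasCrossing (i : α) : DefinableProp fun v => HasCrossing (v i) :=
  (exists_four (fun r _ => r 2 3 ∧ r 3 2 ∧ r 0 2 ∧ ¬r 2 0 ∧ ¬r 0 3 ∧ r 1 3 ∧ ¬r 3 1 ∧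
    ¬r 1 2) i).congr fun v => by simp [HasCrossing]

theorem isPointed (i : α) : DefinableProp fun v => IsPointed (v i) :=
  ((exists_four (fun r _ => r 0 1 ∧ ¬r 1 0) i).and
    (exists_four (fun r e => ¬(¬e 0 1 → r 0 1 ∨ r 1 0)) i).not).congr fun v => by
      simp [IsPointed, or_iff_not_imp_left]

theorem numberGE (i j : α) : DefinableProp fun v => NumberGE (v i) (v j) :=
  (isFull j).and <| ex <| (covBy (inl j) (inr ())).and <|
    (le (inr ()) (inl i)).and (isPointed (inr ()))

theorem sameNumber (i j : α) : DefinableProp fun v => SameNumber (v i) (v j) :=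
  all ((numberGE (inl i) (inr ())).iff (numberGE (inl j) (inr ())))

theorem isReflexive (i : α) : DefinableProp fun v => IsReflexive (v i) :=
  (exists_four (fun r _ => ¬r 0 0) i).not.congr fun v => by simp [IsReflexive]

theorem sameNumbers (i j k : α) : DefinableProp fun v => SameNumbers (v i) (v j) (v k) :=
  all <| ((covBy (inl i) (inr ())).and (le (inr ()) (inl j))).imp <|
    ex <| ((covBy (inl (inl i)) (inr ())).and (le (inr ()) (inl (inl k)))).and
      (sameNumber (inl (inr ())) (inr ()))

theorem isFreeVertex (i j k : α) : DefinableProp fun v => IsFreeVertex (v i) (v j) (v k) :=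
  ((covBy i k).and (le k j)).and (isFreeExt k)

theorem isFreePair (i j k : α) : DefinableProp fun v => IsFreePair (v i) (v j) (v k) :=
  (ex <| (covBy (inl i) (inr ())).and <| (covBy (inr ()) (inl k)).and (le (inl k) (inl j))).and
    (allCovers (isFreeExt ()) i k)

theorem isNumbered (i j : α) : DefinableProp fun v => IsNumbered (v i) (v j) :=
  all <| (isFreePair (inl i) (inl j) (inr ())).imp <|
    (hasSeparatedPair _ (inr ())).and (hasCrossing (inr ())).not

theorem numberLE (i j k : α) : DefinableProp fun v => NumberLE (v i) (v j) (v k) :=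
  (all <| (isFreeVertex (inl i) (inl j) (inr ())).imp <|
    ex <| (isFreeVertex (inl (inl i)) (inl (inl k)) (inr ())).and <|
      (sameNumber (inl (inr ())) (inr ())).and <|
      (isReflexive (inl (inr ()))).imp (isReflexive (inr ()))).and <|
  all <| all <| (isFreePair (inl (inl i)) (inl (inl j)) (inl (inr ()))).imp <|
    (isFreePair (inl (inl i)) (inl (inl k)) (inr ())).imp <|
    (sameNumbers (inl (inl i)) (inl (inr ())) (inr ())).imp <|
    ((hasSeparatedPair _ (inl (inr ()))).imp (hasSeparatedPair _ (inr ()))).and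
      ((hasSeparatedPair _ (inl (inr ()))).imp (hasSeparatedPair _ (inr ())))

end DefinableProp

namespace FinDigraph

variable {K T W X Y Z Z' : FinDigraph} {Q S : Set Z.V} {Q' S' : Set Z'.V} {v w : Z.V}
  {v' w' : Z'.V}

theorem SameNumber.equiv_iff {W' Y' : FinDigraph} (hW : W ≈ W') (hY : Y ≈ Y') :
    SameNumber W Y ↔ SameNumber W' Y' :=
  (DefinableProp.sameNumber false true).equiv_iff (v := fun b => cond b Y W)
    (w := fun b => cond b Y' W') (Bool.rec hW hY)

theorem isReflexive_induce_insert (hQ : ∀ x ∈ Q, ∀ y ∈ Q, Z.Adj x y) :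
    IsReflexive (Z.induce (insert v Q) (Set.insert_nonempty _ _)) ↔ Z.Adj v v := by
  simp only [IsReflexive, forall_induce, induce_adj, Set.forall_mem_insert]
  exact and_iff_left fun x hx => hQ x hx x hx

namespace IsScale

theorem hasSeparatedPair_iff (h : IsScale K Q) (c : Prop → Prop → Prop) (hv : IsFreeAt Q v)
    (hw : IsFreeAt Q w) (hX : X ≈ Z.induce (insert w (insert v Q)) (Set.insert_nonempty _ _)) :
    HasSeparatedPair c X ↔
      (¬outNbrs Q w ⊆ outNbrs Q v ∧ c (Z.Adj v w) (Z.Adj w v)) ∨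
        (¬outNbrs Q v ⊆ outNbrs Q w ∧ c (Z.Adj w v) (Z.Adj v w)) :=
  ((DefinableProp.hasSeparatedPair c ()).equiv_iff fun _ => hX).trans
    (h.hasSeparatedPair_induce_iff c hv hw)

theorem hasCrossing_iff (h : IsScale K Q) (hv : IsFreeAt Q v) (hw : IsFreeAt Q w)
    (hX : X ≈ Z.induce (insert w (insert v Q)) (Set.insert_nonempty _ _)) :
    HasCrossing X ↔ ¬outNbrs Q v ⊆ outNbrs Q w ∧ ¬outNbrs Q w ⊆ outNbrs Q v :=
  ((DefinableProp.hasCrossing ()).equiv_iff fun _ => hX).trans (h.hasCrossing_induce_iff hv hw)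

theorem isNumbered_iff (h : IsScale K Q) : IsNumbered K Z ↔ IsNumberedOn Q := by
  constructor
  · intro hN v hv w hw hvw
    have hX := Setoid.refl (Z.induce (insert w (insert v Q)) (Set.insert_nonempty _ _))
    obtain ⟨hsep, hcross⟩ := hN _ (h.isFreePair_iff.2 ⟨v, w, hv, hw, hvw, hX⟩)
    rw [h.hasSeparatedPair_iff _ hv hw hX] at hsep
    rw [h.hasCrossing_iff hv hw hX] at hcross
    simp only [ssubset_iff_subset_not_subset]
    tauto
  · intro hN X hX
    obtain ⟨v, w, hv, hw, hvw, hX⟩ := h.isFreePair_iff.1 hX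
    rw [h.hasSeparatedPair_iff _ hv hw hX, h.hasCrossing_iff hv hw hX]
    have := hN v hv w hw hvw
    simp only [ssubset_iff_subset_not_subset] at this
    tauto

theorem isReflexive_iff (h : IsScale K Q)
    (hW : W ≈ Z.induce (insert v Q) (Set.insert_nonempty _ _)) : IsReflexive W ↔ Z.Adj v v :=
  ((DefinableProp.isReflexive ()).equiv_iff fun _ => hW).trans (isReflexive_induce_insert h.adj)

theorem sameNumber_iff (h : IsScale K Q) (h' : IsScale K Q') (hv : IsFreeAt Q v)
    (hv' : IsFreeAt Q' v') (hW : W ≈ Z.induce (insert v Q) (Set.insert_nonempty _ _))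
    (hY : Y ≈ Z'.induce (insert v' Q') (Set.insert_nonempty _ _)) :
    SameNumber W Y ↔ number Q v = number Q' v' :=
  (SameNumber.equiv_iff hW hY).trans (sameNumber_induce_iff h.adj h'.adj hv hv')

theorem sameNumbers_induce_iff (h : IsScale K Q) (h' : IsScale K Q') {hS : S.Nonempty}
    {hS' : S'.Nonempty} (hQS : Q ⊆ S) (hQS' : Q' ⊆ S') (hfree : ∀ u ∈ S, u ∉ Q → IsFreeAt Q u)
    (hfree' : ∀ u ∈ S', u ∉ Q' → IsFreeAt Q' u) :
    SameNumbers K (Z.induce S hS) (Z'.induce S' hS') ↔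
      ∀ u ∈ S, u ∉ Q → ∃ u' ∈ S', u' ∉ Q' ∧ number Q u = number Q' u' := by
  simp only [SameNumbers, h.isOnlyCopy.covBy_and_le_induce_iff hQS,
    h'.isOnlyCopy.covBy_and_le_induce_iff hQS']
  constructor
  · intro hnum u hu huQ
    obtain ⟨Y, ⟨u', hu', hu'Q, hY⟩, hWY⟩ := hnum _ ⟨u, hu, huQ, Setoid.refl _⟩
    exact ⟨u', hu', hu'Q,
      (h.sameNumber_iff h' (hfree u hu huQ) (hfree' u' hu' hu'Q) (Setoid.refl _) hY).1 hWY⟩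
  · rintro hnum W ⟨u, hu, huQ, hW⟩
    obtain ⟨u', hu', hu'Q, heq⟩ := hnum u hu huQ
    exact ⟨_, ⟨u', hu', hu'Q, Setoid.refl _⟩,
      (h.sameNumber_iff h' (hfree u hu huQ) (hfree' u' hu' hu'Q) hW (Setoid.refl _)).2 heq⟩

theorem sameNumbers_iff (h : IsScale K Q) (h' : IsScale K Q') (hv : IsFreeAt Q v)
    (hw : IsFreeAt Q w) (hv' : IsFreeAt Q' v') (hw' : IsFreeAt Q' w')
    (hX : X ≈ Z.induce (insert w (insert v Q)) (Set.insert_nonempty _ _))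
    (hT : T ≈ Z'.induce (insert w' (insert v' Q')) (Set.insert_nonempty _ _)) :
    SameNumbers K X T ↔ (number Q v = number Q' v' ∨ number Q v = number Q' w') ∧
      (number Q w = number Q' v' ∨ number Q w = number Q' w') := by
  refine ((DefinableProp.sameNumbers (0 : Fin 3) 1 2).equiv_iff (v := ![K, X, T])
    (w := ![K, _, _]) (Fin.cons (Setoid.refl K) (Fin.cons hX (Fin.cons hT nofun)))).trans
    ((h.sameNumbers_induce_iff h' (hS := Set.insert_nonempty _ _) (hS' := Set.insert_nonempty _ _)
    ((Set.subset_insert _ _).trans (Set.subset_insert _ _))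
    ((Set.subset_insert _ _).trans (Set.subset_insert _ _)) ?_ ?_).trans ?_)
  · rintro u (rfl | rfl | hu) huQ
    exacts [hw, hv, absurd hu huQ]
  · rintro u (rfl | rfl | hu) huQ
    exacts [hw', hv', absurd hu huQ]
  · have hvQ := h.notMem hv
    have hwQ := h.notMem hw
    have hvQ' := h'.notMem hv'
    have hwQ' := h'.notMem hw'
    simp only [Set.mem_insert_iff]
    grind

/-- The two instances of `HasSeparatedPair` see the edge from the smaller to the larger number and
the reverse edge; which of the two comes from `v` to `w` is the same on both sides, because the
numbers are. -/
theorem hasSeparatedPair_imp_iff (h : IsScale K Q) (h' : IsScale K Q') (hN : IsNumberedOn Q)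
    (hN' : IsNumberedOn Q') (hv : IsFreeAt Q v) (hw : IsFreeAt Q w) (hv' : IsFreeAt Q' v')
    (hw' : IsFreeAt Q' w') (hvw : v ≠ w) (hvv' : number Q v = number Q' v')
    (hww' : number Q w = number Q' w')
    (hX : X ≈ Z.induce (insert w (insert v Q)) (Set.insert_nonempty _ _))
    (hT : T ≈ Z'.induce (insert w' (insert v' Q')) (Set.insert_nonempty _ _)) :
    (HasSeparatedPair (fun e _ => e) X → HasSeparatedPair (fun e _ => e) T) ∧
      (HasSeparatedPair (fun _ e => e) X → HasSeparatedPair (fun _ e => e) T) ↔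
    (Z.Adj v w → Z'.Adj v' w') ∧ (Z.Adj w v → Z'.Adj w' v') := by
  have hne : number Q v ≠ number Q w := (hN.number_inj hv hw).not.2 hvw
  have hvw' : v' ≠ w' := by
    rintro rfl
    exact hne (hvv'.trans hww'.symm)
  simp only [h.hasSeparatedPair_iff _ hv hw hX, h'.hasSeparatedPair_iff _ hv' hw' hT,
    hN.not_subset_iff hv hw hvw, hN.not_subset_iff hw hv hvw.symm,
    hN'.not_subset_iff hv' hw' hvw', hN'.not_subset_iff hw' hv' hvw'.symm, ← hvv', ← hww']
  rcases hne.lt_or_gt with hlt | hlt <;> simp only [hlt, hlt.not_gt, true_and, false_and,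
    or_false, false_or]
  exact and_comm

theorem exists_of_numberLE (h : IsScale K Q) (h' : IsScale K Q') (hN : IsNumberedOn Q)
    (hN' : IsNumberedOn Q') (hle : NumberLE K Z Z') : ∃ φ : Z.V → Z'.V,
      (∀ v, IsFreeAt Q v → IsFreeAt Q' (φ v) ∧ number Q v = number Q' (φ v)) ∧
      ∀ v w, IsFreeAt Q v → IsFreeAt Q w → Z.Adj v w → Z'.Adj (φ v) (φ w) := by
  have exists_vertex (v : Z.V) : ∃ v', IsFreeAt Q v →
      (IsFreeAt Q' v' ∧ number Q v = number Q' v') ∧ (Z.Adj v v → Z'.Adj v' v') := by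
    by_cases hv : IsFreeAt Q v
    · obtain ⟨Y, hY, hnum, hloop⟩ := hle.1 _ (h.isFreeVertex_iff.2 ⟨v, hv, Setoid.refl _⟩)
      obtain ⟨v', hv', hYv'⟩ := h'.isFreeVertex_iff.1 hY
      rw [h.sameNumber_iff h' hv hv' (Setoid.refl _) hYv'] at hnum
      rw [h.isReflexive_iff (Setoid.refl _), h'.isReflexive_iff hYv'] at hloop
      exact ⟨v', fun _ => ⟨⟨hv', hnum⟩, hloop⟩⟩
    · exact ⟨Classical.arbitrary _, fun hv' => absurd hv' hv⟩
  choose φ hφ using exists_vertex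
  refine ⟨φ, fun v hv => (hφ v hv).1, fun v w hv hw => ?_⟩
  obtain rfl | hvw := eq_or_ne v w
  · exact (hφ v hv).2
  obtain ⟨⟨hv', hnumv⟩, -⟩ := hφ v hv
  obtain ⟨⟨hw', hnumw⟩, -⟩ := hφ w hw
  have hφvw : φ v ≠ φ w := fun heq =>
    hvw ((hN.number_inj hv hw).1 (by rw [hnumv, hnumw, heq]))
  refine ((h.hasSeparatedPair_imp_iff h' hN hN' hv hw hv' hw' hvw hnumv hnumw (Setoid.refl _)
    (Setoid.refl _)).1 (hle.2 _ _ (h.isFreePair_iff.2 ⟨v, w, hv, hw, hvw, Setoid.refl _⟩)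
      (h'.isFreePair_iff.2 ⟨φ v, φ w, hv', hw', hφvw, Setoid.refl _⟩) ?_)).1
  exact (h.sameNumbers_iff h' hv hw hv' hw' (Setoid.refl _) (Setoid.refl _)).2
    ⟨.inl hnumv, .inr hnumw⟩

theorem numberLE_of_hom (h : IsScale K Q) (h' : IsScale K Q') (hN : IsNumberedOn Q)
    (hN' : IsNumberedOn Q') {φ : Z.V → Z'.V}
    (hφ : ∀ v, IsFreeAt Q v → IsFreeAt Q' (φ v) ∧ number Q v = number Q' (φ v))
    (hadj : ∀ v w, IsFreeAt Q v → IsFreeAt Q w → Z.Adj v w → Z'.Adj (φ v) (φ w)) :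
    NumberLE K Z Z' := by
  refine ⟨fun W hW => ?_, fun X T hX hT hnum => ?_⟩
  · obtain ⟨v, hv, hW⟩ := h.isFreeVertex_iff.1 hW
    refine ⟨_, h'.isFreeVertex_iff.2 ⟨φ v, (hφ v hv).1, Setoid.refl _⟩,
      (h.sameNumber_iff h' hv (hφ v hv).1 hW (Setoid.refl _)).2 (hφ v hv).2, ?_⟩
    rw [h.isReflexive_iff hW, h'.isReflexive_iff (Setoid.refl _)]
    exact hadj v v hv hv
  · obtain ⟨v, w, hv, hw, hvw, hX⟩ := h.isFreePair_iff.1 hX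
    obtain ⟨v', w', hv', hw', -, hT⟩ := h'.isFreePair_iff.1 hT
    obtain ⟨hφv, hnumv⟩ := hφ v hv
    obtain ⟨hφw, hnumw⟩ := hφ w hw
    have hφvw : φ v ≠ φ w := fun heq =>
      hvw ((hN.number_inj hv hw).1 (by rw [hnumv, hnumw, heq]))
    rw [h.sameNumbers_iff h' hv hw hv' hw' hX hT, hnumv, hnumw, hN'.number_inj hφv hv',
      hN'.number_inj hφv hw', hN'.number_inj hφw hv', hN'.number_inj hφw hw'] at hnum
    have hpair : insert w' (insert v' Q') = insert (φ w) (insert (φ v) Q') := by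
      have := Set.insert_comm w' v' Q'
      grind
    simp only [hpair] at hT
    exact (h.hasSeparatedPair_imp_iff h' hN hN' hv hw hφv hφw hvw hnumv hnumw hX hT).2
      ⟨hadj v w hv hw, hadj w v hw hv⟩

theorem numberLE_iff (h : IsScale K Q) (h' : IsScale K Q') (hN : IsNumberedOn Q)
    (hN' : IsNumberedOn Q') : NumberLE K Z Z' ↔ ∃ φ : Z.V → Z'.V,
      (∀ v, IsFreeAt Q v → IsFreeAt Q' (φ v) ∧ number Q v = number Q' (φ v)) ∧
      ∀ v w, IsFreeAt Q v → IsFreeAt Q w → Z.Adj v w → Z'.Adj (φ v) (φ w) :=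
  ⟨h.exists_of_numberLE h' hN hN', fun ⟨_, hφ, hadj⟩ => h.numberLE_of_hom h' hN hN' hφ hadj⟩

end IsScale

end FinDigraph

/-! ### Numbered frames -/

namespace FinDigraph

variable {G H K Z Z' : FinDigraph} {Q R : Set Z.V} {Q' R' : Set Z'.V}

namespace IsFrameOn

theorem isScale (h : IsFrameOn Q R) (hK : IsOnlyCopy K Q) : IsScale K Q where
  isOnlyCopy := hK
  adj := h.adj
  nontrivial := h.nontrivial_left

theorem isFreeAt_iff (h : IsFrameOn Q R) {v : Z.V} : IsFreeAt Q v ↔ v ∈ (Q ∪ R)ᶜ := by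
  rw [Set.mem_compl_iff, Set.mem_union, not_or]
  refine ⟨fun hv => ⟨fun hvQ => hv.1 v hvQ (h.adj v hvQ v hvQ), fun hvR => ?_⟩,
    fun hv => h.free_left v hv.1 hv.2⟩
  obtain ⟨x, hx, hvx⟩ := hv.2
  exact hv.1 x hx ((h.joined x hx v hvR).2 hvx)

theorem numberLE_iff (h : IsFrameOn Q R) (hK : IsOnlyCopy K Q) (hN : IsNumberedOn Q)
    (h' : IsFrameOn Q' R') (hK' : IsOnlyCopy K Q') (hN' : IsNumberedOn Q') {i : Emb G Z}
    (hi : Set.range i = (Q ∪ R)ᶜ) {i' : Emb H Z'} (hi' : Set.range i' = (Q' ∪ R')ᶜ) :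
    NumberLE K Z Z' ↔ ∃ t : G.V → H.V, (∀ x, number Q (i x) = number Q' (i' (t x))) ∧
      ∀ x y, G.Adj x y → H.Adj (t x) (t y) := by
  simp only [(h.isScale hK).numberLE_iff (h'.isScale hK') hN hN', h.isFreeAt_iff, h'.isFreeAt_iff,
    ← hi, ← hi', Set.forall_mem_range]
  constructor
  · rintro ⟨φ, hφ, hadj⟩
    choose t ht using fun x => (hφ x).1
    refine ⟨t, fun x => ht x ▸ (hφ x).2, fun x y hxy => ?_⟩
    rw [← i'.map_rel_iff, ht, ht]
    exact hadj _ _ ⟨x, rfl⟩ ⟨y, rfl⟩ (i.map_rel_iff.2 hxy)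
  · rintro ⟨t, hnum, hadj⟩
    have extend_apply (x : G.V) :
        Function.extend i (i' ∘ t) (fun _ => Classical.arbitrary _) (i x) = i' (t x) :=
      i.injective.extend_apply _ _ x
    refine ⟨Function.extend i (i' ∘ t) fun _ => Classical.arbitrary _, ?_, ?_⟩
    · intro x
      rw [extend_apply]
      exact ⟨⟨t x, rfl⟩, hnum x⟩
    · rintro _ _ ⟨x, rfl⟩ ⟨y, rfl⟩ hxy
      rw [extend_apply, extend_apply]
      exact i'.map_rel_iff.2 (hadj x y (i.map_rel_iff.1 hxy))

end IsFrameOn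

section NumberedFrame

variable {N : ℕ} (ν : G.V → Fin N)

/-- The frame around `G` in which the vertex `v` has the number `ν v`. The summands are `G`, the
full set and the edgeless set. -/
def numberedFrame : FinDigraph where
  V := G.V ⊕ Fin (N + 2) ⊕ Fin (N + 2)
  graph := ⟨fun
    | .inl v, .inl w => G.Adj v w
    | .inl v, .inr (.inl q) => q.val < ν v
    | .inl _, .inr (.inr _) => True
    | .inr (.inl _), .inl _ => False
    | .inr (.inl _), .inr _ => True
    | .inr (.inr _), .inl _ => True
    | .inr (.inr _), .inr _ => False⟩

/-- The full set of `numberedFrame ν`. -/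
def fullPart : Set (numberedFrame ν).V := Set.range fun q => .inr (.inl q)

/-- The edgeless set of `numberedFrame ν`. -/
def edgelessPart : Set (numberedFrame ν).V := Set.range fun r => .inr (.inr r)

/-- The inclusion of `G`. -/
def embNumberedFrame : Emb G (numberedFrame ν) := ⟨⟨.inl, Sum.inl_injective⟩, Iff.rfl⟩

theorem range_embNumberedFrame :
    Set.range (embNumberedFrame ν) = (fullPart ν ∪ edgelessPart ν)ᶜ := by
  ext (v | q | r)
  · exact iff_of_true ⟨v, rfl⟩ (by rintro (⟨_, ⟨⟩⟩ | ⟨_, ⟨⟩⟩))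
  · exact iff_of_false (by rintro ⟨_, ⟨⟩⟩) (not_not.2 (.inl ⟨q, rfl⟩))
  · exact iff_of_false (by rintro ⟨_, ⟨⟩⟩) (not_not.2 (.inr ⟨r, rfl⟩))

theorem isFrameOn_numberedFrame : IsFrameOn (fullPart ν) (edgelessPart ν) where
  adj := by
    rintro _ ⟨q, rfl⟩ _ ⟨p, rfl⟩
    trivial
  not_adj := by
    rintro _ ⟨q, rfl⟩ _ ⟨p, rfl⟩
    exact not_false
  nontrivial_left :=
    ⟨_, ⟨0, rfl⟩, _, ⟨1, rfl⟩, (Sum.inr_injective.comp Sum.inl_injective).ne Fin.zero_ne_one⟩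
  nontrivial_right :=
    ⟨_, ⟨0, rfl⟩, _, ⟨1, rfl⟩, (Sum.inr_injective.comp Sum.inr_injective).ne Fin.zero_ne_one⟩
  joined := by
    rintro _ ⟨q, rfl⟩ _ ⟨r, rfl⟩
    exact iff_of_true trivial not_false
  free_left := by
    rintro (v | q | r) hQ hR
    · refine ⟨?_, _, ⟨Fin.last _, rfl⟩, (show ν v ≤ N + 1 by omega).not_gt⟩
      rintro _ ⟨q, rfl⟩
      exact not_false
    · exact (hQ ⟨q, rfl⟩).elim
    · exact (hR ⟨r, rfl⟩).elim
  free_right := by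
    rintro (v | q | r) hQ hR
    · refine ⟨?_, _, ⟨0, rfl⟩, not_not.2 trivial⟩
      rintro _ ⟨r, rfl⟩
      exact not_not.2 trivial
    · exact (hQ ⟨q, rfl⟩).elim
    · exact (hR ⟨r, rfl⟩).elim

/-- The full digraph on the full set. -/
def embFullPart : Emb (fullDigraph (N + 1)) (numberedFrame ν) :=
  ⟨⟨fun q => .inr (.inl q), Sum.inr_injective.comp Sum.inl_injective⟩, Iff.rfl⟩

/-- The full digraph on the edgeless set, in the dual. -/
def embEdgelessPart : Emb (fullDigraph (N + 1)) (numberedFrame ν).dual :=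
  ⟨⟨fun r => .inr (.inr r), Sum.inr_injective.comp Sum.inr_injective⟩,
    iff_of_true not_false trivial⟩

variable {ν} in
theorem ncard_compl_fullPart_union_edgelessPart_lt (hν : Function.Injective ν) :
    (fullPart ν ∪ edgelessPart ν)ᶜ.ncard < N + 2 := by
  rw [← range_embNumberedFrame, ncard_range]
  have := Nat.card_le_card_of_injective ν hν
  rw [Nat.card_fin] at this
  omega

variable {ν}

theorem isOnlyCopy_fullPart (hν : Function.Injective ν) :
    IsOnlyCopy (fullDigraph (N + 1)) (fullPart ν) :=
  (isFrameOn_numberedFrame ν).isOnlyCopy (embFullPart ν) rfl <|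
    (ncard_compl_fullPart_union_edgelessPart_lt hν).trans_eq
      (ncard_range_fullDigraph (embFullPart ν)).symm

theorem isOnlyCopy_edgelessPart (hν : Function.Injective ν) :
    IsOnlyCopy (Z := (numberedFrame ν).dual) (fullDigraph (N + 1)) (edgelessPart ν) :=
  (isFrameOn_numberedFrame ν).dual.isOnlyCopy (embEdgelessPart ν) rfl <|
    (Set.union_comm _ _ ▸ ncard_compl_fullPart_union_edgelessPart_lt hν).trans_eq
      (ncard_range_fullDigraph (embEdgelessPart ν)).symm

theorem isFrame_numberedFrame (hν : Function.Injective ν) :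
    IsFrame (fullDigraph (N + 1)) (numberedFrame ν) G :=
  isFrame_iff.2 ⟨_, _, _, embNumberedFrame ν, isFrameOn_numberedFrame ν, isOnlyCopy_fullPart hν,
    isOnlyCopy_edgelessPart hν, range_embNumberedFrame ν⟩

theorem outNbrs_embNumberedFrame (v : G.V) : outNbrs (fullPart ν) (embNumberedFrame ν v) =
    embFullPart ν '' Set.Iio (α := Fin (N + 2)) ((ν v).castAdd 2) := by
  ext x
  constructor
  · rintro ⟨⟨q, rfl⟩, hq⟩
    exact ⟨q, hq, rfl⟩
  · rintro ⟨q, hq, rfl⟩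
    exact ⟨⟨q, rfl⟩, hq⟩

theorem number_embNumberedFrame (v : G.V) :
    number (fullPart ν) (embNumberedFrame ν v) = ν v := by
  have card_Iio : (Set.Iio ((ν v).castAdd 2)).ncard = ν v := by
    rw [← Finset.coe_Iio, Set.ncard_coe_finset, Fin.card_Iio, Fin.val_castAdd]
  rw [number, outNbrs_embNumberedFrame]
  exact (Set.ncard_image_of_injective _ (embFullPart ν).injective).trans card_Iio

theorem outNbrs_embNumberedFrame_ssubset {v w : G.V} (hvw : ν v < ν w) :
    outNbrs (fullPart ν) (embNumberedFrame ν v) ⊂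
      outNbrs (fullPart ν) (embNumberedFrame ν w) := by
  rw [outNbrs_embNumberedFrame, outNbrs_embNumberedFrame]
  exact (embFullPart ν).injective.image_strictMono
    (Set.Iio_ssubset_Iio (α := Fin (N + 2)) hvw)

theorem isNumberedOn_fullPart (hν : Function.Injective ν) : IsNumberedOn (fullPart ν) := by
  simp only [IsNumberedOn, (isFrameOn_numberedFrame ν).isFreeAt_iff, ← range_embNumberedFrame,
    Set.forall_mem_range]
  exact fun v w hvw => (hν.ne (ne_of_apply_ne _ hvw)).lt_or_gt.imp
    outNbrs_embNumberedFrame_ssubset outNbrs_embNumberedFrame_ssubset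

end NumberedFrame

/-- A definable relation between `G` and `H` that holds iff `G` is embeddable into `H`: they have
numbered frames with the same scale such that mapping each vertex of `G` to the vertex of `H` with
the same number is a homomorphism. -/
def HaveNumberedFrames (G H : FinDigraph) : Prop :=
  ∃ K Z Z', (IsFrame K Z G ∧ IsNumbered K Z) ∧ (IsFrame K Z' H ∧ IsNumbered K Z') ∧
    NumberLE K Z Z'

theorem Embeds.haveNumberedFrames (h : G.Embeds H) : HaveNumberedFrames G H := by
  obtain ⟨t, ht, hadj⟩ := h
  let ν : H.V → Fin (Nat.card H.V) := Finite.equivFin H.V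
  have hν : Function.Injective ν := (Finite.equivFin H.V).injective
  have hνt : Function.Injective (ν ∘ t) := hν.comp ht
  have isNumbered {G : FinDigraph} {ν : G.V → Fin (Nat.card H.V)} (hν : Function.Injective ν) :
      IsNumbered (fullDigraph _) (numberedFrame ν) :=
    ((isFrameOn_numberedFrame ν).isScale (isOnlyCopy_fullPart hν)).isNumbered_iff.2
      (isNumberedOn_fullPart hν)
  refine ⟨_, _, _, ⟨isFrame_numberedFrame hνt, isNumbered hνt⟩,
    ⟨isFrame_numberedFrame hν, isNumbered hν⟩, ?_⟩
  refine ((isFrameOn_numberedFrame (ν ∘ t)).numberLE_iff (isOnlyCopy_fullPart hνt)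
    (isNumberedOn_fullPart hνt) (isFrameOn_numberedFrame ν) (isOnlyCopy_fullPart hν)
    (isNumberedOn_fullPart hν) (range_embNumberedFrame _) (range_embNumberedFrame _)).2
    ⟨t, fun x => ?_, hadj⟩
  rw [number_embNumberedFrame, number_embNumberedFrame, Function.comp_apply]

theorem HaveNumberedFrames.embeds (h : HaveNumberedFrames G H) : G.Embeds H := by
  obtain ⟨K, Z, Z', ⟨hG, hN⟩, ⟨hH, hN'⟩, hle⟩ := h
  obtain ⟨-, Q, R, i, hZ, hQ, -, hi⟩ := isFrame_iff.1 hG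
  obtain ⟨-, Q', R', i', hZ', hQ', -, hi'⟩ := isFrame_iff.1 hH
  rw [(hZ.isScale hQ).isNumbered_iff] at hN
  rw [(hZ'.isScale hQ').isNumbered_iff] at hN'
  obtain ⟨t, hnum, hadj⟩ := (hZ.numberLE_iff hQ hN hZ' hQ' hN' hi hi').1 hle
  have isFreeAt (x : G.V) : IsFreeAt Q (i x) := hZ.isFreeAt_iff.2 (hi ▸ ⟨x, rfl⟩)
  refine ⟨t, fun x y hxy => i.injective ?_, hadj⟩
  rw [← hN.number_inj (isFreeAt x) (isFreeAt y), hnum, hnum, hxy]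

end FinDigraph

namespace DefinableProp

open FinDigraph Sum

variable {α : Type}

theorem haveNumberedFrames (i j : α) : DefinableProp fun v => HaveNumberedFrames (v i) (v j) :=
  ex <| ex <| ex <|
    ((isFrame (inl (inl (inr ()))) (inl (inr ())) (inl (inl (inl i)))).and
      (isNumbered (inl (inl (inr ()))) (inl (inr ())))).and <|
    ((isFrame (inl (inl (inr ()))) (inr ()) (inl (inl (inl j)))).and
      (isNumbered (inl (inl (inr ()))) (inr ()))).and
    (numberLE (inl (inl (inr ()))) (inl (inr ())) (inr ()))

theorem embeds (i j : α) : DefinableProp fun v => (v i).Embeds (v j) :=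
  (haveNumberedFrames i j).congr fun _ => ⟨Embeds.haveNumberedFrames, HaveNumberedFrames.embeds⟩

end DefinableProp

theorem DigraphType.definableIn_embeds :
    DefinableIn IsSub small {x : Fin 2 → DigraphType | Embeds (x 0) (x 1)} := by
  obtain ⟨s, hs, h⟩ := DefinableProp.embeds (0 : Fin 2) 1
  suffices heq : {x : Fin 2 → DigraphType | Embeds (x 0) (x 1)} = s from heq ▸ hs
  ext x
  choose v hv using fun i => Quotient.exists_rep (x i)
  obtain rfl : (fun i => (Quotient.mk _ (v i) : DigraphType)) = x := funext hv
  exact h v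

theorem theorem1 :
    DigraphType.small.Finite ∧
    DigraphType.DefinableIn DigraphType.IsSub DigraphType.small
      {x : Fin 2 → DigraphType | DigraphType.Embeds (x 0) (x 1)} ∧
    ∀ (n : ℕ) (R : Set (Fin n → DigraphType)),
      DigraphType.DefinableIn DigraphType.Embeds ∅ R →
      DigraphType.DefinableIn DigraphType.IsSub DigraphType.small R := by
  refine ⟨DigraphType.finite_setOf_order_le 4, DigraphType.definableIn_embeds, fun n R hR => ?_⟩
  refine @definable_of_definable_empty Language.order Language.order DigraphType
    (DigraphType.relStructure DigraphType.IsSub) _ _ (DigraphType.relStructure DigraphType.Embeds)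
    _ (fun m r => ?_) _ hR
  cases r
  exact DigraphType.definableIn_embeds
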